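/- Let $[k]=\{1,\dots,k\}$, let $\mathbf U$ be the uniform distribution on $[k]$, and let $d_{TV}(\mathbf p,\mathbf q)=\frac12\|\mathbf p-\mathbf q\|_1$ be the total variation distance. A (non-interactive) private-coin shuffle protocol for $n$ users consists of a randomiser, which maps a data point $x\in[k]$ to a random tuple of messages, and of a randomised analyser; on input $x\in[k]^n$ the users apply the randomiser independently to $x_1,\dots,x_n$ (with no public randomness), a shuffler concatenates their tuples and applies a uniformly random permutation, and the analyser maps the result to "accept" or "reject". The protocol is single-message if every user always sends exactly one message; the messages are bit strings. It is $(\varepsilon,\delta)$-shuffle private if the output $M(x)$ of the shuffler satisfies $\Pr[M(x)\in S]\le e^{\varepsilon}\Pr[M(x')\in S]+\delta$ for every event $S$ and all $x,x'\in[k]^n$ which differ in at most one coordinate. It is an $\alpha$-uniformity tester with sample complexity $n$ if, when $x_1,\dots,x_n$ are i.i.d. samples from a distribution $\mathbf p$ on $[k]$, it outputs "accept" with probability at least $2/3$ if $\mathbf p=\mathbf U$, and "reject" with probability at least $2/3$ if $d_{TV}(\mathbf p,\mathbf U)>\alpha$. **Theorem.** For every $\alpha_0<1$ there is a constant $c>0$,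 which depends only on $\alpha_0$, such that the following holds for all integers $k\ge 1$, $n,\ell\ge 0$ and all reals $\varepsilon>0$, $\delta\in(0,1]$ and $0<\alpha\le\alpha_0$ with $\alpha<1-\frac1k$. If there is a single-message private-coin $(\varepsilon,\delta)$-shuffle private protocol for $n$ users, in which each user always sends at most $\ell$ bits, that is an $\alpha$-uniformity tester over $[k]$ with sample complexity $n$, then $$ n\;\ge\; c\left(\min\left(\frac{k^{3/4}}{\alpha e^{\varepsilon/2}},\;\frac{k^{3/2}}{\alpha^2\,\delta\,2^{\ell}}\right)+\frac{\sqrt k}{\alpha^2}\right). $$ In particular, if moreover $\delta\le k^{3/4}/2^{\ell}$, then $$ n\;\ge\; c\left(\frac{k^{3/4}}{\alpha e^{\varepsilon/2}}+\frac{\sqrt k}{\alpha^2}\right). $$ -/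

import Mathlib

open scoped ENNReal BigOperators

noncomputable section

/-- The joint law of independent random variables `v 0, …, v (n - 1)`, where `v i` has law `q i`. -/
def indepLaw {A : Type} : {n : ℕ} → (Fin n → PMF A) → PMF (Fin n → A)
  | 0, _ => PMF.pure Fin.elim0
  | _ + 1, q => (q 0).bind fun a => (indepLaw fun i => q i.succ).map fun v => Fin.cons a v

/-- The probability mass function of independent random variables is the product of theirs. -/
theorem indepLaw_apply {A : Type} {n : ℕ} (q : Fin n → PMF A) (v : Fin n → A) :
    indepLaw q v = ∏ i, q i (v i) := by
  classical
  induction n with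
  | zero =>
    have h : v = Fin.elim0 := Subsingleton.elim _ _
    simp [indepLaw, h]
  | succ n ih =>
    rw [indepLaw, PMF.bind_apply, Fin.prod_univ_succ, tsum_eq_single (v 0)]
    · rw [PMF.map_apply, tsum_eq_single (Fin.tail v)]
      · rw [ih]
        simp [Fin.tail]
      · intro w hw
        rw [if_neg]
        intro h
        exact hw (by rw [h, Fin.tail_cons])
    · intro a ha
      rw [PMF.map_apply, ENNReal.tsum_eq_zero.mpr, mul_zero]
      intro w
      rw [if_neg]
      intro h
      exact ha (by rw [h, Fin.cons_zero])

/-- The total variation distance `sup_S (p(S) - q(S)) = (1/2) ‖p - q‖₁` of two distributions on a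
finite set. -/
def tvDist {X : Type} [Fintype X] (p q : PMF X) : ℝ :=
  (1 / 2) * ∑ x, |(p x).toReal - (q x).toReal|

/-- `(ε, δ)`-differential privacy of a randomised algorithm `M` on datasets of `n` elements of `X`:
for any two datasets which differ in at most one element, and any event `S`,
`Pr[M x ∈ S] ≤ e ^ ε * Pr[M x' ∈ S] + δ`. -/
def IsDP {X Z : Type} [DecidableEq X] {n : ℕ} (M : (Fin n → X) → PMF Z) (ε δ : ℝ) : Prop :=
  ∀ x x' : Fin n → X, hammingDist x x' ≤ 1 → ∀ S : Set Z,
    (M x).toOuterMeasure S ≤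
      ENNReal.ofReal (Real.exp ε) * (M x').toOuterMeasure S + ENNReal.ofReal δ

/-- The shuffler: it returns a uniformly random permutation of the given tuple of messages. -/
def shuffler {Y : Type} (l : List Y) : PMF (List Y) :=
  (PMF.uniformOfFintype (Equiv.Perm (Fin l.length))).map fun σ =>
    List.ofFn fun i => l.get (σ i)

/-- A non-interactive shuffle protocol with data in `X`, messages in `Y` and outputs in `Z`. All
users apply the same randomiser to their data point and to the `r` public random bits; its outcome
is a tuple of messages. The analyser receives the shuffled messages of all users, and the public
random bits. -/
structure ShuffleProtocol (X Y Z : Type) where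
  /-- the number of public random bits -/
  r : ℕ
  /-- the randomiser -/
  randomiser : X → (Fin r → Bool) → PMF (List Y)
  /-- the analyser -/
  analyser : List Y → (Fin r → Bool) → PMF Z

namespace ShuffleProtocol

/-- The law of the output of the shuffler for `n` users with data `x` and public random bits `u`:
the users apply the randomiser independently of each other, and the concatenation of their tuples of
messages is shuffled. -/
def shuffled {X Y Z : Type} (P : ShuffleProtocol X Y Z) {n : ℕ} (x : Fin n → X)
    (u : Fin P.r → Bool) : PMF (List Y) :=
  (indepLaw fun i => P.randomiser (x i) u).bind fun m => shuffler (List.ofFn m).flatten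

/-- The law of the output of the protocol for `n` users with data `x`. -/
def output {X Y Z : Type} (P : ShuffleProtocol X Y Z) {n : ℕ} (x : Fin n → X) : PMF Z :=
  (PMF.uniformOfFintype (Fin P.r → Bool)).bind fun u =>
    (P.shuffled x u).bind fun y => P.analyser y u

/-- A protocol is private-coin if there are no public random bits. -/
def IsPrivateCoin {X Y Z : Type} (P : ShuffleProtocol X Y Z) : Prop :=
  P.r = 0

/-- A protocol is single-message if every user always sends exactly one message. -/
def IsSingleMessage {X Y Z : Type} (P : ShuffleProtocol X Y Z) : Prop :=
  ∀ x u, ∀ m ∈ (P.randomiser x u).support, m.length = 1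

/-- In a protocol whose messages are bit strings, every user always sends at most `ℓ` bits. -/
def SendsAtMost {X Z : Type} (P : ShuffleProtocol X (List Bool) Z) (ℓ : ℕ) : Prop :=
  ∀ x u, ∀ m ∈ (P.randomiser x u).support, (m.map List.length).sum ≤ ℓ

/-- `(ε, δ)`-shuffle differential privacy for `n` users: for all public random bits, the output of
the shuffler is `(ε, δ)`-differentially private. -/
def IsShuffleDP {X Y Z : Type} [DecidableEq X] (P : ShuffleProtocol X Y Z) (n : ℕ) (ε δ : ℝ) :
    Prop :=
  ∀ u : Fin P.r → Bool, IsDP (fun x : Fin n → X => P.shuffled x u) ε δ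

/-- The law of the output of the protocol when each of the `n` users holds one of `n` i.i.d. samples
from `p`. -/
def outputOn {X Y Z : Type} (P : ShuffleProtocol X Y Z) (n : ℕ) (p : PMF X) : PMF Z :=
  (indepLaw fun _ : Fin n => p).bind fun x => P.output x

/-- The protocol for `n` users is an `α`-uniformity tester, with `n` samples, one for each user: on
uniform data it outputs "accept" (that is, `true`) with probability at least `2 / 3`, and on data
whose distribution is at total variation distance more than `α` from uniform, it outputs "reject"
(that is, `false`) with probability at least `2 / 3`. -/
def IsUniformityTester {k : ℕ} [NeZero k] {Y : Type} (P : ShuffleProtocol (Fin k) Y Bool) (n : ℕ)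
    (α : ℝ) : Prop :=
  2 / 3 ≤ P.outputOn n (PMF.uniformOfFintype (Fin k)) true ∧
    ∀ p : PMF (Fin k), α < tvDist p (PMF.uniformOfFintype (Fin k)) →
      2 / 3 ≤ P.outputOn n p false

end ShuffleProtocol

end

/-!
Let `W x y` be the probability that a user with data `x` sends the message `y`, and let
`s y = ∑ x, W x y`. In a private-coin single-message protocol the analyser sees `n` independent
messages, in random order, so that it tests whether the law of a message is the image of the uniform
distribution `U` under the channel `W`. The lower bound is governed by the matrix
`H x x' = ∑ y, W x y * W x' y / s y`, more precisely by any bound `T` on its trace: the core of the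
proof is that `n * α ^ 2 * T ≥ c * k ^ (3 / 2)` (`IsChannelTester.exists_const_le`).

Always `T = k` is possible (`trace_le_card`), which gives the term `√k / α ^ 2`. For a shuffle private
protocol, the event that a given message occurs shows that the channel is locally private, with
`e ^ ε` replaced by `n * e ^ ε` (`ShuffleProtocol.randomiser_le_of_isShuffleDP`). Summing over the at
most `2 ^ (ℓ + 1)` messages, one may take `T = n * e ^ ε + δ * 2 ^ (ℓ + 1)` (`trace_le_of_private`),
and solving for `n` gives the minimum in the theorem (`min_le_of_trace_bound`).

The core bound is an instance of the second-moment method (`le_sum_exp_correlation`): it suffices to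
find a random perturbation `U + (a / k) (s - sbar)` of `U` at distance more than `α` from `U`, such
that for two independent copies of it the exponential of `n a ^ 2 / k` times the value of the bilinear
form of `H` at them has expectation close to one. With independent coordinates this would fail, as `H`
may have a few eigenvalues of order one, so the perturbation has to be nearly orthogonal to the
corresponding eigenvectors, while the distance may be required to be close to one, which forces `s` to
be the indicator of a sparse set. Both are achieved by the Gram–Schmidt walk
(`exists_subgaussian_rounding`), which rounds a point of the cube to a vertex such that a given sum of
vectors of length at most one is subgaussian with a constant variance proxy. It is applied to vectors
whose Gram matrix is `(1 + (k / T') H) / 2`, where `T'` is a multiple of `T`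
(`exists_channel_rounding`). Thus `s` has a variance proxy of order `(1 + (k / T') H)⁻¹`, which
suppresses the large eigenvalues of `H`. The few points `x` at which `H x x` is much larger than
average, for which these vectors would be too long, are left out of the rounding
(`exists_sparse_rounding`).

Only small test vectors are needed in the subgaussian bound, because the second-moment method is
applied where all exponents are small; this keeps the analysis of the walk elementary
(`concaveOn_exp_sub_sq`). The second moment of the vector sum shows that, with probability close to
one, the first copy of the perturbation makes the linear form in the second copy small; conditioning
on this event takes the place of a bound on the exponential moments of a quadratic form.
-/

section

open Finset

/-! ### Random variables with finitely many values -/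

/-- A random element of `S` taking finitely many values: a finite probability space `Ω` with weights
`w`, and a map `val` from it to `S`. -/
structure FiniteLaw (S : Type*) where
  /-- the sample space -/
  Ω : Type
  /-- the sample space is finite -/
  fintype : Fintype Ω
  /-- the probability weights -/
  w : Ω → ℝ
  /-- the random element -/
  val : Ω → S
  w_nonneg : ∀ ω, 0 ≤ w ω
  w_sum : ∑ ω, w ω = 1

namespace FiniteLaw

attribute [instance] FiniteLaw.fintype

variable {S : Type*}

/-- The expectation of `f` under a finite law. -/
def expect (μ : FiniteLaw S) (f : S → ℝ) : ℝ := ∑ ω, μ.w ω * f (μ.val ω)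

/-- The law of a deterministic element. -/
def dirac (s : S) : FiniteLaw S where
  Ω := Unit
  fintype := inferInstance
  w _ := 1
  val _ := s
  w_nonneg _ := zero_le_one
  w_sum := by simp

/-- The mixture of two finite laws with weights `a` and `b`. -/
def mix (μ ν : FiniteLaw S) (a b : ℝ) (ha : 0 ≤ a) (hb : 0 ≤ b) (hab : a + b = 1) :
    FiniteLaw S where
  Ω := μ.Ω ⊕ ν.Ω
  fintype := inferInstance
  w := Sum.elim (fun ω => a * μ.w ω) (fun ω => b * ν.w ω)
  val := Sum.elim μ.val ν.val
  w_nonneg := by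
    rintro (ω | ω)
    · exact mul_nonneg ha (μ.w_nonneg ω)
    · exact mul_nonneg hb (ν.w_nonneg ω)
  w_sum := by
    simp [Fintype.sum_sum_type, ← Finset.mul_sum, μ.w_sum, ν.w_sum, hab]

theorem expect_dirac (s : S) (f : S → ℝ) : (dirac s).expect f = f s := by
  have h : (dirac s).expect f = ∑ _x : Unit, 1 * f s := rfl
  rw [h]
  simp

theorem expect_mix (μ ν : FiniteLaw S) {a b : ℝ} (ha : 0 ≤ a) (hb : 0 ≤ b) (hab : a + b = 1)
    (f : S → ℝ) : (mix μ ν a b ha hb hab).expect f = a * μ.expect f + b * ν.expect f := by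
  have h : (mix μ ν a b ha hb hab).expect f =
      ∑ x : μ.Ω ⊕ ν.Ω, Sum.elim (fun ω => a * μ.w ω) (fun ω => b * ν.w ω) x
        * f (Sum.elim μ.val ν.val x) := rfl
  rw [h, Fintype.sum_sum_type]
  simp [expect, Finset.mul_sum, mul_assoc]

theorem expect_const (μ : FiniteLaw S) (c : ℝ) : (μ.expect fun _ => c) = c := by
  simp [expect, ← Finset.sum_mul, μ.w_sum]

theorem expect_add (μ : FiniteLaw S) (f g : S → ℝ) :
    (μ.expect fun s => f s + g s) = μ.expect f + μ.expect g := by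
  simp [expect, mul_add, Finset.sum_add_distrib]

theorem expect_const_mul (μ : FiniteLaw S) (c : ℝ) (f : S → ℝ) :
    (μ.expect fun s => c * f s) = c * μ.expect f := by
  simp only [expect, Finset.mul_sum]
  exact Finset.sum_congr rfl fun _ _ => by ring

theorem expect_sum (μ : FiniteLaw S) {J : Type*} (t : Finset J) (f : J → S → ℝ) :
    (μ.expect fun s => ∑ j ∈ t, f j s) = ∑ j ∈ t, μ.expect (f j) := by
  simp only [expect, Finset.mul_sum]
  exact Finset.sum_comm

theorem expect_mono (μ : FiniteLaw S) {f g : S → ℝ} (h : ∀ ω, f (μ.val ω) ≤ g (μ.val ω)) :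
    μ.expect f ≤ μ.expect g :=
  Finset.sum_le_sum fun ω _ => mul_le_mul_of_nonneg_left (h ω) (μ.w_nonneg ω)

end FiniteLaw

/-! ### Subgaussian rounding by the Gram–Schmidt walk -/

/-- For small `y`, the Gaussian factor makes up for the convexity of the exponential: this is the
one-dimensional inequality behind each step of the Gram–Schmidt walk. -/
theorem concaveOn_exp_sub_sq {w y : ℝ} (hw : |w| ≤ y) (hy : y ≤ 1 / 5) :
    ConcaveOn ℝ (Set.Icc 0 1) fun x : ℝ => Real.exp (w * x - y ^ 2 * x ^ 2) := by
  have h1 : ∀ x : ℝ, HasDerivAt (fun x : ℝ => Real.exp (w * x - y ^ 2 * x ^ 2))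
      (Real.exp (w * x - y ^ 2 * x ^ 2) * (w - y ^ 2 * (2 * x))) x := by
    intro x
    have := (((hasDerivAt_id x).const_mul w).sub (((hasDerivAt_id x).pow 2).const_mul (y ^ 2))).exp
    refine this.congr_deriv ?_
    simp
  have h2 : ∀ x : ℝ, HasDerivAt (fun x : ℝ =>
      Real.exp (w * x - y ^ 2 * x ^ 2) * (w - y ^ 2 * (2 * x)))
      (Real.exp (w * x - y ^ 2 * x ^ 2) * (w - y ^ 2 * (2 * x)) * (w - y ^ 2 * (2 * x))
        + Real.exp (w * x - y ^ 2 * x ^ 2) * (0 - y ^ 2 * (2 * 1))) x := by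
    intro x
    exact (h1 x).mul ((hasDerivAt_const x w).sub
      (((hasDerivAt_id x).const_mul 2).const_mul (y ^ 2)))
  refine concaveOn_of_hasDerivWithinAt2_nonpos (convex_Icc 0 1)
    (fun x _ => (h1 x).continuousAt.continuousWithinAt)
    (fun x _ => (h1 x).hasDerivWithinAt) (fun x _ => (h2 x).hasDerivWithinAt) ?_
  intro x hx
  rw [interior_Icc] at hx
  have hw' := abs_le.mp hw
  have hy0 : 0 ≤ y := (abs_nonneg w).trans hw
  have hyx : y * x ≤ 1 / 5 := by nlinarith [hx.1, hx.2]
  have hb : |w - y ^ 2 * (2 * x)| ≤ 7 / 5 * y := by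
    rw [abs_le]
    constructor
    · nlinarith [hx.1]
    · nlinarith [hx.1, mul_nonneg (sq_nonneg y) hx.1.le]
  have hsq : (w - y ^ 2 * (2 * x)) ^ 2 ≤ (7 / 5 * y) ^ 2 := sq_le_sq' (abs_le.mp hb).1 (abs_le.mp hb).2
  have he := Real.exp_pos (w * x - y ^ 2 * x ^ 2)
  have : (w - y ^ 2 * (2 * x)) ^ 2 - 2 * y ^ 2 ≤ 0 := by nlinarith [sq_nonneg y]
  calc _ = Real.exp (w * x - y ^ 2 * x ^ 2) * ((w - y ^ 2 * (2 * x)) ^ 2 - 2 * y ^ 2) := by ring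
    _ ≤ 0 := mul_nonpos_of_nonneg_of_nonpos he.le this

section GramSchmidtWalk

variable {ι : Type*} {E : Type*} [NormedAddCommGroup E] [InnerProductSpace ℝ E]
  [FiniteDimensional ℝ E]

/-- Moving from a point in the interior of a cube in direction `u ≠ 0`, one stays in the cube until
some coordinate reaches `0` or `1`. -/
theorem exists_step_to_boundary (A : Finset ι) (s u : ι → ℝ) (hs : ∀ i ∈ A, s i ∈ Set.Ioo 0 1)
    {p : ι} (hp : p ∈ A) (hu : u p ≠ 0) :
    ∃ δ : ℝ, 0 < δ ∧ (∀ i ∈ A, s i + δ * u i ∈ Set.Icc 0 1) ∧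
      ∃ i ∈ A, s i + δ * u i = 0 ∨ s i + δ * u i = 1 := by
  classical
  -- `t i` is the time at which coordinate `i` leaves the unit interval
  let t : ι → ℝ := fun i => if 0 < u i then (1 - s i) / u i else s i / -u i
  obtain ⟨i, hi, hmin⟩ := (A.filter fun i => u i ≠ 0).exists_min_image t
    ⟨p, by simp [hp, hu]⟩
  rw [mem_filter] at hi
  have htpos : ∀ j ∈ A, u j ≠ 0 → 0 < t j := by
    intro j hj huj
    simp only [t]
    split_ifs with h
    · exact div_pos (by linarith [(hs j hj).2]) h
    · have : u j < 0 := lt_of_le_of_ne (not_lt.mp h) huj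
      exact div_pos (hs j hj).1 (by linarith)
  refine ⟨t i, htpos i hi.1 hi.2, ?_, i, hi.1, ?_⟩
  · intro j hj
    have hsj := hs j hj
    have ht0 := htpos i hi.1 hi.2
    rcases lt_trichotomy (u j) 0 with h | h | h
    · have hle := hmin j (by simp [hj, h.ne])
      have hle' : t i ≤ s j / -u j := by simpa [t, h.not_gt] using hle
      rw [le_div_iff₀ (by linarith)] at hle'
      constructor <;> nlinarith [hsj.1, hsj.2]
    · simp only [h, mul_zero, add_zero]
      exact ⟨hsj.1.le, hsj.2.le⟩
    · have hle := hmin j (by simp [hj, h.ne'])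
      have hle' : t i ≤ (1 - s j) / u j := by simpa [t, h] using hle
      rw [le_div_iff₀ h] at hle'
      constructor <;> nlinarith [hsj.1, hsj.2]
  · by_cases h : 0 < u i
    · right
      simp only [t, if_pos h]
      field_simp
      ring
    · left
      simp only [t, if_neg h]
      have := hi.2
      field_simp
      ring

/-- The squared norm of the projection of `v` to the span of the vectors `b i`, `i ∈ A`. -/
noncomputable def spanNormSq (b : ι → E) (A : Finset ι) (v : E) : ℝ :=
  ‖(Submodule.span ℝ (b '' (A : Set ι))).starProjection v‖ ^ 2

theorem norm_sq_starProjection_add {K L : Submodule ℝ E} (h : K ≤ L) (v : E) :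
    ‖L.starProjection v‖ ^ 2 =
      ‖K.starProjection v‖ ^ 2 + ‖L.starProjection v - K.starProjection v‖ ^ 2 := by
  have h1 : K.starProjection (L.starProjection v) = K.starProjection v := by
    have := Submodule.starProjection_comp_starProjection_of_le h
    exact congrArg (fun f => f v) this
  have h2 : inner ℝ (L.starProjection v - K.starProjection v) (K.starProjection v) = 0 := by
    have := K.starProjection_inner_eq_zero (L.starProjection v) (K.starProjection v)
      (K.starProjection_apply_mem v)
    rwa [h1] at this
  have h3 := norm_add_sq_eq_norm_sq_add_norm_sq_of_inner_eq_zero _ _ h2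
  rw [sub_add_cancel] at h3
  nlinarith [h3]

theorem spanNormSq_mono (b : ι → E) {A B : Finset ι} (h : A ⊆ B) (v : E) :
    spanNormSq b A v ≤ spanNormSq b B v := by
  have hle : Submodule.span ℝ (b '' (A : Set ι)) ≤ Submodule.span ℝ (b '' (B : Set ι)) :=
    Submodule.span_mono (Set.image_mono (by exact_mod_cast h))
  have := norm_sq_starProjection_add hle v
  unfold spanNormSq
  nlinarith [sq_nonneg ‖(Submodule.span ℝ (b '' (B : Set ι))).starProjection v -
    (Submodule.span ℝ (b '' (A : Set ι))).starProjection v‖]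

theorem spanNormSq_nonneg (b : ι → E) (A : Finset ι) (v : E) : 0 ≤ spanNormSq b A v :=
  sq_nonneg _

theorem spanNormSq_le (b : ι → E) (A : Finset ι) (v : E) : spanNormSq b A v ≤ ‖v‖ ^ 2 := by
  have := Submodule.norm_starProjection_apply_le (Submodule.span ℝ (b '' (A : Set ι))) v
  exact pow_le_pow_left₀ (norm_nonneg _) this 2

variable [DecidableEq ι]

/-- The direction in which the walk moves: the pivot moves at unit speed, and the other coordinates
make the vector sum move orthogonally to their span. -/
theorem exists_walk_direction (b : ι → E) {A : Finset ι} {p : ι} (hp : p ∈ A)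
    (hb : ‖b p‖ ≤ 1) :
    ∃ u : ι → ℝ, u p = 1 ∧ (∀ i ∉ A, u i = 0) ∧ ∀ v : E,
      (inner ℝ (∑ i ∈ A, u i • b i) v) ^ 2 ≤ spanNormSq b A v - spanNormSq b (A.erase p) v := by
  set K := Submodule.span ℝ (b '' ((A.erase p : Finset ι) : Set ι)) with hK
  set L := Submodule.span ℝ (b '' (A : Set ι)) with hL
  have hKL : K ≤ L := Submodule.span_mono (Set.image_mono (by exact_mod_cast A.erase_subset p))
  have hmem : K.starProjection (b p) ∈ K := K.starProjection_apply_mem _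
  obtain ⟨c, hc⟩ : ∃ c : ι → ℝ, ∑ i ∈ A.erase p, c i • b i = K.starProjection (b p) := by
    have h := hmem
    exact (Submodule.mem_span_image_finset_iff_exists_fun' ℝ).mp h
  refine ⟨fun i => if i = p then 1 else if i ∈ A then -c i else 0, by simp, ?_, ?_⟩
  · intro i hi
    have : i ≠ p := fun h => hi (h ▸ hp)
    simp [this, hi]
  · intro v
    have hsum : ∑ i ∈ A, (if i = p then 1 else if i ∈ A then -c i else 0) • b i
        = b p - K.starProjection (b p) := by
      rw [← Finset.add_sum_erase A _ hp, ← hc, sub_eq_add_neg, ← Finset.sum_neg_distrib]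
      congr 1
      · simp
      · refine Finset.sum_congr rfl fun i hi => ?_
        rw [mem_erase] at hi
        simp [hi.1, hi.2]
    rw [hsum]
    set β := b p - K.starProjection (b p) with hβ
    have hβK : ∀ w ∈ K, inner ℝ β w = 0 := fun w hw => K.starProjection_inner_eq_zero _ _ hw
    have hβL : β ∈ L := L.sub_mem
      (Submodule.subset_span ⟨p, by exact_mod_cast hp, rfl⟩) (hKL hmem)
    have hβ1 : ‖β‖ ≤ 1 := by
      have h := hβK _ hmem
      have h3 := norm_add_sq_eq_norm_sq_add_norm_sq_of_inner_eq_zero _ _ h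
      rw [hβ, sub_add_cancel] at h3
      nlinarith [norm_nonneg β, norm_nonneg (b p), norm_nonneg (K.starProjection (b p))]
    have hin : inner ℝ β v = inner ℝ β (L.starProjection v - K.starProjection v) := by
      have h1 : inner ℝ (v - L.starProjection v) β = 0 := L.starProjection_inner_eq_zero _ _ hβL
      have h2 := hβK _ (K.starProjection_apply_mem v)
      rw [inner_sub_right, h2, sub_zero]
      rw [real_inner_comm, inner_sub_right, sub_eq_zero] at h1
      exact h1
    have hcs := abs_real_inner_le_norm β (L.starProjection v - K.starProjection v)
    have hN := norm_sq_starProjection_add hKL v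
    have : spanNormSq b A v - spanNormSq b (A.erase p) v
        = ‖L.starProjection v - K.starProjection v‖ ^ 2 := by
      rw [spanNormSq, spanNormSq]
      linarith
    rw [this, hin, ← sq_abs]
    refine pow_le_pow_left₀ (abs_nonneg _) (hcs.trans ?_) 2
    nlinarith [norm_nonneg (L.starProjection v - K.starProjection v)]

variable [Fintype ι]

/-- There is a random rounding of the coordinates `i ∈ A` of `s₀` to `{0, 1}` for which the vector
sum `∑ (s i - s₀ i) • b i` is subgaussian, with a variance proxy that interpolates, depending on the
value of the pivot `p`, between the projection to the span of all vectors and the one to the span of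
the vectors other than `b p`. -/
def HasPivotRounding (b : ι → E) (A : Finset ι) (p : ι) (s₀ : ι → ℝ) : Prop :=
  ∃ μ : FiniteLaw (ι → ℝ),
    (∀ ω, (∀ i ∈ A, μ.val ω i = 0 ∨ μ.val ω i = 1) ∧ ∀ i ∉ A, μ.val ω i = s₀ i) ∧
    ∀ v : E, ‖v‖ ≤ 1 / 5 →
      (μ.expect fun s => Real.exp (inner ℝ (∑ i, (s i - s₀ i) • b i) v)) ≤
        Real.exp (s₀ p ^ 2 * spanNormSq b (A.erase p) v + (1 - s₀ p ^ 2) * spanNormSq b A v)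

theorem hasPivotRounding_of_integral_coordinate (b : ι → E) (A : Finset ι)
    (ih : ∀ B ⊂ A, ∀ p ∈ B, ∀ s₀ : ι → ℝ, (∀ i ∈ B, s₀ i ∈ Set.Icc 0 1) →
      HasPivotRounding b B p s₀)
    {p : ι} (hp : p ∈ A) (s₀ : ι → ℝ) (hs : ∀ i ∈ A, s₀ i ∈ Set.Icc 0 1)
    {j : ι} (hj : j ∈ A) (hj' : s₀ j = 0 ∨ s₀ j = 1) : HasPivotRounding b A p s₀ := by
  have hsq : 0 ≤ s₀ p ^ 2 ∧ s₀ p ^ 2 ≤ 1 :=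
    ⟨sq_nonneg _, pow_le_one₀ (hs p hp).1 (hs p hp).2⟩
  by_cases hne : (A.erase j).Nonempty
  · -- the walk goes on without coordinate `j`, with a new pivot if `j` was the pivot
    obtain ⟨q, hq, hqp⟩ : ∃ q ∈ A.erase j, j ≠ p → q = p := by
      by_cases hjp : j = p
      · obtain ⟨q, hq⟩ := hne
        exact ⟨q, hq, fun h => absurd hjp h⟩
      · exact ⟨p, mem_erase.mpr ⟨Ne.symm hjp, hp⟩, fun _ => rfl⟩
    obtain ⟨μ, hμ, hμv⟩ := ih (A.erase j) (erase_ssubset hj) q hq s₀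
      fun i hi => hs i (mem_of_mem_erase hi)
    refine ⟨μ, fun ω => ⟨fun i hi => ?_, fun i hi => (hμ ω).2 i fun h => hi (mem_of_mem_erase h)⟩,
      fun v hv => (hμv v hv).trans (Real.exp_le_exp.mpr ?_)⟩
    · by_cases hij : i = j
      · rw [hij, (hμ ω).2 j (by simp)]
        exact hj'
      · exact (hμ ω).1 i (mem_erase.mpr ⟨hij, hi⟩)
    · have hsq' : 0 ≤ s₀ q ^ 2 ∧ s₀ q ^ 2 ≤ 1 :=
        ⟨sq_nonneg _, pow_le_one₀ (hs q (mem_of_mem_erase hq)).1 (hs q (mem_of_mem_erase hq)).2⟩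
      have m1 := spanNormSq_mono b (A.erase_subset j) v
      have m2 := spanNormSq_mono b (erase_subset q (A.erase j)) v
      by_cases hjp : j = p
      · subst hjp
        rcases hj' with h | h <;> rw [h] <;> nlinarith
      · obtain rfl := hqp hjp
        have m3 : spanNormSq b ((A.erase j).erase q) v ≤ spanNormSq b (A.erase q) v :=
          spanNormSq_mono b (erase_subset_erase q (A.erase_subset j)) v
        nlinarith
  · have hA : A = {j} := by
      rw [not_nonempty_iff_eq_empty] at hne
      rw [← insert_erase hj, hne, insert_empty_eq]
    subst hA
    refine ⟨FiniteLaw.dirac s₀, fun ω => ⟨fun i hi => ?_, fun _ _ => rfl⟩, fun v _ => ?_⟩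
    · rw [mem_singleton.mp hi]
      exact hj'
    · rw [FiniteLaw.expect_dirac]
      refine Real.exp_le_exp.mpr ?_
      simp only [sub_self, zero_smul, sum_const_zero, inner_zero_left]
      have := spanNormSq_nonneg b (({j} : Finset ι).erase p) v
      have := spanNormSq_nonneg b ({j} : Finset ι) v
      nlinarith

theorem hasPivotRounding (b : ι → E) (A : Finset ι) (hb : ∀ i ∈ A, ‖b i‖ ≤ 1) {p : ι}
    (hp : p ∈ A) (s₀ : ι → ℝ) (hs : ∀ i ∈ A, s₀ i ∈ Set.Icc 0 1) : HasPivotRounding b A p s₀ := by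
  induction A using Finset.strongInduction generalizing p s₀ with
  | H A ih =>
  have ih' : ∀ B ⊂ A, ∀ p ∈ B, ∀ s₀ : ι → ℝ, (∀ i ∈ B, s₀ i ∈ Set.Icc 0 1) →
      HasPivotRounding b B p s₀ :=
    fun B hB p hp s₀ hs => ih B hB (fun i hi => hb i (hB.1 hi)) hp s₀ hs
  by_cases hex : ∃ j ∈ A, s₀ j = 0 ∨ s₀ j = 1
  · obtain ⟨j, hj, hj'⟩ := hex
    exact hasPivotRounding_of_integral_coordinate b A ih' hp s₀ hs hj hj'
  · push Not at hex
    have hs' : ∀ i ∈ A, s₀ i ∈ Set.Ioo 0 1 := fun i hi =>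
      ⟨lt_of_le_of_ne (hs i hi).1 (hex i hi).1.symm, lt_of_le_of_ne (hs i hi).2 (hex i hi).2⟩
    obtain ⟨u, hup, huA, huv⟩ := exists_walk_direction b hp (hb p hp)
    obtain ⟨δ₁, hδ₁, hin₁, j₁, hj₁, hj₁'⟩ := exists_step_to_boundary A s₀ u hs' hp (by simp [hup])
    obtain ⟨δ₂, hδ₂, hin₂, j₂, hj₂, hj₂'⟩ :=
      exists_step_to_boundary A s₀ (-u) hs' hp (by simp [hup])
    obtain ⟨μ, hμ, hμv⟩ := hasPivotRounding_of_integral_coordinate b A ih' hp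
      (fun i => s₀ i + δ₁ * u i) hin₁ hj₁ hj₁'
    obtain ⟨ν, hν, hνv⟩ := hasPivotRounding_of_integral_coordinate b A ih' hp
      (fun i => s₀ i + δ₂ * (-u) i) hin₂ hj₂ hj₂'
    have hδ : 0 < δ₁ + δ₂ := by linarith
    -- the weights make the step a martingale difference
    have hab : δ₂ / (δ₁ + δ₂) + δ₁ / (δ₁ + δ₂) = 1 := by field_simp; ring
    refine ⟨FiniteLaw.mix μ ν (δ₂ / (δ₁ + δ₂)) (δ₁ / (δ₁ + δ₂)) (by positivity) (by positivity) hab,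
      ?_, ?_⟩
    · rintro (ω | ω)
      · exact ⟨(hμ ω).1, fun i hi => ((hμ ω).2 i hi).trans (by simp [huA i hi])⟩
      · exact ⟨(hν ω).1, fun i hi => ((hν ω).2 i hi).trans (by simp [huA i hi])⟩
    · intro v hv
      rw [FiniteLaw.expect_mix]
      set N := spanNormSq b A v
      set N' := spanNormSq b (A.erase p) v
      set w : ℝ := inner ℝ (∑ i ∈ A, u i • b i) v with hw
      have huniv : ∑ i, u i • b i = ∑ i ∈ A, u i • b i := by
        refine (Finset.sum_subset (subset_univ A) fun i _ hi => ?_).symm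
        simp [huA i hi]
      have hNN : N' ≤ N := spanNormSq_mono b (A.erase_subset p) v
      have hwN : w ^ 2 ≤ N - N' := huv v
      have hN : N ≤ ‖v‖ ^ 2 := spanNormSq_le b A v
      have hN' : 0 ≤ N' := spanNormSq_nonneg b _ v
      set y := Real.sqrt (N - N') with hy
      have hy2 : y ^ 2 = N - N' := Real.sq_sqrt (by linarith)
      have hwy : |w| ≤ y := Real.abs_le_sqrt hwN
      have hy5 : y ≤ 1 / 5 := by
        refine Real.sqrt_le_iff.mpr ⟨by norm_num, ?_⟩
        nlinarith [norm_nonneg v]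
      have key : ∀ (κ : FiniteLaw (ι → ℝ)) (t : ℝ),
          (κ.expect fun s => Real.exp (inner ℝ (∑ i, (s i - (s₀ i + t * u i)) • b i) v)) ≤
            Real.exp ((s₀ p + t * u p) ^ 2 * N' + (1 - (s₀ p + t * u p) ^ 2) * N) →
          (κ.expect fun s => Real.exp (inner ℝ (∑ i, (s i - s₀ i) • b i) v)) ≤
            Real.exp (N - w * s₀ p) *
              Real.exp (w * (s₀ p + t) - y ^ 2 * (s₀ p + t) ^ 2) := by
        intro κ t h
        have e1 : ∀ s : ι → ℝ, inner ℝ (∑ i, (s i - s₀ i) • b i) v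
            = t * w + inner ℝ (∑ i, (s i - (s₀ i + t * u i)) • b i) v := by
          intro s
          have : ∑ i, (s i - s₀ i) • b i
              = t • ∑ i, u i • b i + ∑ i, (s i - (s₀ i + t * u i)) • b i := by
            rw [Finset.smul_sum, ← Finset.sum_add_distrib]
            refine Finset.sum_congr rfl fun i _ => ?_
            rw [smul_smul, ← add_smul]
            congr 1
            ring
          rw [this, inner_add_left, huniv, real_inner_smul_left]
        simp only [e1, Real.exp_add]
        rw [FiniteLaw.expect_const_mul, ← Real.exp_add]
        refine (mul_le_mul_of_nonneg_left h (Real.exp_pos _).le).trans (le_of_eq ?_)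
        rw [← Real.exp_add, hup, hy2]
        congr 1
        ring
      have k1 := key μ δ₁ (hμv v hv)
      have k2 := key ν (-δ₂) (by simpa using hνv v hv)
      have hconc := (concaveOn_exp_sub_sq hwy hy5).2
        (by simpa [hup] using hin₁ p hp : s₀ p + δ₁ ∈ Set.Icc (0 : ℝ) 1)
        (by simpa [hup] using hin₂ p hp : s₀ p + -δ₂ ∈ Set.Icc (0 : ℝ) 1)
        (by positivity : 0 ≤ δ₂ / (δ₁ + δ₂)) (by positivity : 0 ≤ δ₁ / (δ₁ + δ₂)) hab
      have hmean : δ₂ / (δ₁ + δ₂) * (s₀ p + δ₁) + δ₁ / (δ₁ + δ₂) * (s₀ p + -δ₂) = s₀ p := by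
        field_simp
        ring
      simp only [smul_eq_mul] at hconc
      rw [hmean] at hconc
      calc _ ≤ δ₂ / (δ₁ + δ₂) * (Real.exp (N - w * s₀ p) *
              Real.exp (w * (s₀ p + δ₁) - y ^ 2 * (s₀ p + δ₁) ^ 2)) +
            δ₁ / (δ₁ + δ₂) * (Real.exp (N - w * s₀ p) *
              Real.exp (w * (s₀ p + -δ₂) - y ^ 2 * (s₀ p + -δ₂) ^ 2)) := by gcongr
        _ = Real.exp (N - w * s₀ p) * (δ₂ / (δ₁ + δ₂) *
              Real.exp (w * (s₀ p + δ₁) - y ^ 2 * (s₀ p + δ₁) ^ 2) +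
            δ₁ / (δ₁ + δ₂) * Real.exp (w * (s₀ p + -δ₂) - y ^ 2 * (s₀ p + -δ₂) ^ 2)) := by ring
        _ ≤ Real.exp (N - w * s₀ p) * Real.exp (w * s₀ p - y ^ 2 * s₀ p ^ 2) := by gcongr
        _ = _ := by
          rw [← Real.exp_add, hy2]
          congr 1
          ring

/-- **Subgaussian rounding.** The Gram–Schmidt walk rounds the coordinates in `A` of a point of the
unit cube to `{0, 1}`, such that the corresponding sum of vectors of length at most one is
subgaussian with a variance proxy that does not depend on the number of vectors. -/
theorem exists_subgaussian_rounding (b : ι → E) (A : Finset ι) (hb : ∀ i ∈ A, ‖b i‖ ≤ 1)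
    (s₀ : ι → ℝ) (hs : ∀ i ∈ A, s₀ i ∈ Set.Icc 0 1) :
    ∃ μ : FiniteLaw (ι → ℝ),
      (∀ ω, (∀ i ∈ A, μ.val ω i = 0 ∨ μ.val ω i = 1) ∧ ∀ i ∉ A, μ.val ω i = s₀ i) ∧
      ∀ v : E, ‖v‖ ≤ 1 / 5 →
        (μ.expect fun s => Real.exp (inner ℝ (∑ i, (s i - s₀ i) • b i) v)) ≤
          Real.exp (‖v‖ ^ 2) := by
  rcases A.eq_empty_or_nonempty with rfl | ⟨p, hp⟩
  · refine ⟨FiniteLaw.dirac s₀, fun ω => ⟨by simp, fun _ _ => rfl⟩, fun v _ => ?_⟩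
    rw [FiniteLaw.expect_dirac]
    exact Real.exp_le_exp.mpr (by simp)
  · obtain ⟨μ, hμ, hμv⟩ := hasPivotRounding b A hb hp s₀ hs
    refine ⟨μ, hμ, fun v hv => (hμv v hv).trans (Real.exp_le_exp.mpr ?_)⟩
    have h0 : s₀ p ^ 2 ≤ 1 := pow_le_one₀ (hs p hp).1 (hs p hp).2
    have := spanNormSq_mono b (A.erase_subset p) v
    have := spanNormSq_le b A v
    nlinarith [sq_nonneg (s₀ p)]

end GramSchmidtWalk

section SecondMoments

variable {E : Type*} [NormedAddCommGroup E] [InnerProductSpace ℝ E]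

theorem FiniteLaw.expect_inner_sq_le {S : Type*} (μ : FiniteLaw S) (X : S → E)
    (h : ∀ v : E, ‖v‖ ≤ 1 / 5 → (μ.expect fun s => Real.exp (inner ℝ (X s) v)) ≤
      Real.exp (‖v‖ ^ 2)) (v : E) :
    (μ.expect fun s => (inner ℝ (X s) v) ^ 2) ≤ 3 * ‖v‖ ^ 2 := by
  rcases eq_or_ne v 0 with rfl | hv
  · simp [FiniteLaw.expect]
  have hv' : 0 < ‖v‖ := norm_pos_iff.mpr hv
  -- it suffices to treat vectors of norm `1 / 5`, by homogeneity
  set t : ℝ := 1 / (5 * ‖v‖) with ht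
  have ht0 : 0 < t := by positivity
  have hn : ‖t • v‖ = 1 / 5 := by
    rw [norm_smul, Real.norm_of_nonneg ht0.le, ht]
    field_simp
  have h1 := h (t • v) hn.le
  have h2 := h (-(t • v)) (by rw [norm_neg, hn])
  rw [norm_neg] at h2
  rw [hn] at h1 h2
  have hexp : Real.exp ((1 / 5 : ℝ) ^ 2) ≤ 1 + 3 / 50 := by
    have := Real.exp_bound_div_one_sub_of_interval (x := (1 / 5 : ℝ) ^ 2) (by norm_num) (by norm_num)
    refine this.trans ?_
    norm_num
  have hpt : ∀ x : ℝ, x ^ 2 ≤ Real.exp x + Real.exp (-x) + (-2) := by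
    intro x
    have h1 : |x / 2| ≤ |Real.sinh (x / 2)| := by
      rw [Real.abs_sinh]
      exact Real.self_le_sinh_iff.mpr (abs_nonneg _)
    have h2 := sq_le_sq.mpr h1
    have h3 := Real.cosh_two_mul (x / 2)
    have h4 := Real.cosh_sq (x / 2)
    rw [mul_div_cancel₀ x two_ne_zero, Real.cosh_eq] at h3
    linarith
  have hmain : (μ.expect fun s => t ^ 2 * (inner ℝ (X s) v) ^ 2) ≤ 3 / 25 := by
    calc _ ≤ μ.expect fun s => Real.exp (inner ℝ (X s) (t • v)) +
          Real.exp (inner ℝ (X s) (-(t • v))) + (-2) := by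
          refine μ.expect_mono fun ω => ?_
          have := hpt (inner ℝ (X (μ.val ω)) (t • v))
          rw [inner_neg_right]
          refine le_trans (le_of_eq ?_) this
          rw [inner_smul_right]
          ring
      _ ≤ 3 / 25 := by
          rw [FiniteLaw.expect_add, FiniteLaw.expect_add, FiniteLaw.expect_const]
          linarith
  rw [FiniteLaw.expect_const_mul] at hmain
  have : t ^ 2 = 1 / (25 * ‖v‖ ^ 2) := by rw [ht]; field_simp; norm_num
  rw [this, div_mul_eq_mul_div, div_le_iff₀ (by positivity)] at hmain
  linarith

/-- A subgaussian vector sum has second moment at most proportional to the number of vectors, rather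
than to the dimension of the space, as it lives in the span of the vectors. -/
theorem FiniteLaw.expect_norm_sq_le [FiniteDimensional ℝ E] {ι S : Type*} [Fintype ι]
    (μ : FiniteLaw S) (b : ι → E) (c : S → ι → ℝ)
    (h : ∀ v : E, ‖v‖ ≤ 1 / 5 →
      (μ.expect fun s => Real.exp (inner ℝ (∑ i, c s i • b i) v)) ≤ Real.exp (‖v‖ ^ 2)) :
    (μ.expect fun s => ‖∑ i, c s i • b i‖ ^ 2) ≤ 3 * Fintype.card ι := by
  set K := Submodule.span ℝ (Set.range b) with hK
  let e := stdOrthonormalBasis ℝ K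
  have hmem : ∀ s, ∑ i, c s i • b i ∈ K := fun s =>
    K.sum_mem fun i _ => K.smul_mem _ (Submodule.subset_span ⟨i, rfl⟩)
  have hnorm : ∀ s, ‖∑ i, c s i • b i‖ ^ 2 =
      ∑ j, (inner ℝ (∑ i, c s i • b i) (e j : E)) ^ 2 := by
    intro s
    have := e.sum_sq_norm_inner_left ⟨_, hmem s⟩
    simpa using this.symm
  simp only [hnorm]
  rw [FiniteLaw.expect_sum]
  calc _ ≤ ∑ j : Fin (Module.finrank ℝ K), (3 : ℝ) := by
        refine Finset.sum_le_sum fun j _ => ?_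
        have := μ.expect_inner_sq_le _ h (e j : E)
        have he : ‖(e j : E)‖ = 1 := e.orthonormal.1 j
        rw [he] at this
        linarith
    _ ≤ _ := by
        have : Module.finrank ℝ K ≤ Fintype.card ι := finrank_range_le_card b
        simp only [Finset.sum_const, Finset.card_univ, Fintype.card_fin, nsmul_eq_mul]
        have : (Module.finrank ℝ K : ℝ) ≤ Fintype.card ι := by exact_mod_cast this
        linarith

end SecondMoments

/-! ### The second-moment method -/

section ChiSquare

/-- Ingster's second-moment method. If a test distinguishes `n` samples of `π` from `n` samples of
the perturbation `π + D z`, for each `z`, then the expectation of the exponential of the correlation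
of two independent random perturbations is bounded away from one. -/
theorem le_sum_exp_correlation {Z Y : Type*} [Fintype Z] [Fintype Y] (n : ℕ) (π : Y → ℝ)
    (hπ : ∀ y, 0 ≤ π y) (hπ1 : ∑ y, π y = 1) (ν : Z → ℝ) (hν : ∀ z, 0 ≤ ν z) (hν1 : ∑ z, ν z = 1)
    (D : Z → Y → ℝ) (hD : ∀ z, ∑ y, D z y = 0) (hD0 : ∀ z y, π y = 0 → D z y = 0)
    (hpos : ∀ z, ν z ≠ 0 → ∀ y, 0 ≤ π y + D z y) (f : (Fin n → Y) → ℝ) (hf0 : ∀ m, 0 ≤ f m)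
    (hf1 : ∀ m, f m ≤ 1) (h0 : 2 / 3 ≤ ∑ m : Fin n → Y, (∏ i, π (m i)) * f m)
    (h1 : ∀ z, ν z ≠ 0 → ∑ m : Fin n → Y, (∏ i, (π (m i) + D z (m i))) * f m ≤ 1 / 3) :
    10 / 9 ≤ ∑ z, ∑ z', ν z * ν z' * Real.exp (n * ∑ y, D z y * D z' y / π y) := by
  classical
  have hprod : ∀ q : Y → ℝ, ∑ m : Fin n → Y, ∏ i, q (m i) = (∑ y, q y) ^ n := by
    intro q
    rw [Finset.sum_pow', Fintype.piFinset_univ]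
  let P : (Fin n → Y) → ℝ := fun m => ∏ i, π (m i)
  let L : Z → (Fin n → Y) → ℝ := fun z m => ∏ i, (π (m i) + D z (m i))
  let h : (Fin n → Y) → ℝ := fun m => ∑ z, ν z * L z m - P m
  have hP : ∀ m, 0 ≤ P m := fun m => Finset.prod_nonneg fun i _ => hπ _
  have hPL : ∀ z m, P m = 0 → L z m = 0 := by
    intro z m hm
    obtain ⟨i, -, hi⟩ := Finset.prod_eq_zero_iff.mp hm
    exact Finset.prod_eq_zero (mem_univ i) (by rw [hi, hD0 z _ hi, add_zero])
  have hPh : ∀ m, P m = 0 → h m = 0 := by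
    intro m hm
    simp [h, hPL _ m hm, hm]
  have hPsum : ∑ m, P m = 1 := by rw [hprod, hπ1, one_pow]
  have hLsum : ∀ z, ∑ m, L z m = 1 := by
    intro z
    rw [hprod fun y => π y + D z y, Finset.sum_add_distrib, hπ1, hD, add_zero, one_pow]
  have hgap : ∑ m, h m * f m ≤ -(1 / 3) := by
    have e : ∑ m, h m * f m = ∑ z, ν z * ∑ m, L z m * f m - ∑ m, P m * f m := by
      simp only [h, sub_mul, Finset.sum_sub_distrib, Finset.sum_mul, Finset.mul_sum]
      rw [Finset.sum_comm]
      simp only [mul_assoc]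
    have e2 : ∑ z, ν z * ∑ m, L z m * f m ≤ ∑ z, ν z * (1 / 3) := by
      refine Finset.sum_le_sum fun z _ => ?_
      by_cases hz : ν z = 0
      · simp [hz]
      · exact mul_le_mul_of_nonneg_left (h1 z hz) (hν z)
    rw [← Finset.sum_mul, hν1] at e2
    have h0' : 2 / 3 ≤ ∑ m, P m * f m := h0
    linarith
  have hcs : (∑ m, h m * f m) ^ 2 ≤ (∑ m, h m ^ 2 / P m) * ∑ m, P m * f m ^ 2 := by
    refine Finset.sum_sq_le_sum_mul_sum_of_sq_le_mul _ (fun m _ => div_nonneg (sq_nonneg _) (hP m))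
      (fun m _ => mul_nonneg (hP m) (sq_nonneg _)) fun m _ => ?_
    by_cases hm : P m = 0
    · simp [hPh m hm, hm]
    · refine le_of_eq ?_
      field_simp
  have hf2 : ∑ m, P m * f m ^ 2 ≤ 1 := by
    rw [← hPsum]
    refine Finset.sum_le_sum fun m _ => ?_
    have : f m ^ 2 ≤ 1 := pow_le_one₀ (hf0 m) (hf1 m)
    nlinarith [hP m]
  have hchi0 : 0 ≤ ∑ m, h m ^ 2 / P m :=
    Finset.sum_nonneg fun m _ => div_nonneg (sq_nonneg _) (hP m)
  have hchi : 1 / 9 ≤ ∑ m, h m ^ 2 / P m := by nlinarith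
  have hexpand : ∑ m, h m ^ 2 / P m = ∑ z, ∑ z', ν z * ν z' * ∑ m, L z m * L z' m / P m - 1 := by
    have e : ∀ m, h m ^ 2 / P m =
        ∑ z, ∑ z', ν z * ν z' * (L z m * L z' m / P m) - 2 * ∑ z, ν z * L z m + P m := by
      intro m
      by_cases hm : P m = 0
      · simp [hPh m hm, hPL _ m hm, hm]
      · have : ∑ z, ∑ z', ν z * ν z' * (L z m * L z' m / P m) = (∑ z, ν z * L z m) ^ 2 / P m := by
          rw [sq, Finset.sum_mul_sum, Finset.sum_div]
          refine Finset.sum_congr rfl fun z _ => ?_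
          rw [Finset.sum_div]
          exact Finset.sum_congr rfl fun z' _ => by ring
        rw [this]
        simp only [h]
        field_simp
        ring
    have e3 : ∑ m, ∑ z, ν z * L z m = 1 := by
      rw [Finset.sum_comm]
      simp only [← Finset.mul_sum, hLsum, mul_one, hν1]
    have e4 : ∑ m, ∑ z, ∑ z', ν z * ν z' * (L z m * L z' m / P m) =
        ∑ z, ∑ z', ν z * ν z' * ∑ m, L z m * L z' m / P m := by
      rw [Finset.sum_comm]
      refine Finset.sum_congr rfl fun z _ => ?_
      rw [Finset.sum_comm]
      exact Finset.sum_congr rfl fun z' _ => (Finset.mul_sum _ _ _).symm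
    simp only [e]
    rw [Finset.sum_add_distrib, Finset.sum_sub_distrib, ← Finset.mul_sum, e3, e4, hPsum]
    ring
  have hcorr : ∀ z z', ν z ≠ 0 → ν z' ≠ 0 →
      ∑ m, L z m * L z' m / P m ≤ Real.exp (n * ∑ y, D z y * D z' y / π y) := by
    intro z z' hz hz'
    have e : ∀ m, L z m * L z' m / P m =
        ∏ i, (π (m i) + D z (m i)) * (π (m i) + D z' (m i)) / π (m i) := by
      intro m
      rw [Finset.prod_div_distrib, Finset.prod_mul_distrib]
    simp only [e]
    rw [hprod fun y => (π y + D z y) * (π y + D z' y) / π y]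
    have e2 : ∑ y, (π y + D z y) * (π y + D z' y) / π y = ∑ y, D z y * D z' y / π y + 1 := by
      have : ∀ y, (π y + D z y) * (π y + D z' y) / π y =
          D z y * D z' y / π y + (π y + D z y + D z' y) := by
        intro y
        by_cases hy : π y = 0
        · simp [hy, hD0]
        · field_simp
          ring
      simp only [this, Finset.sum_add_distrib, hπ1, hD, add_zero]
    have e3 : 0 ≤ ∑ y, (π y + D z y) * (π y + D z' y) / π y :=
      Finset.sum_nonneg fun y _ => div_nonneg (mul_nonneg (hpos z hz y) (hpos z' hz' y)) (hπ y)
    rw [Real.exp_nat_mul]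
    refine pow_le_pow_left₀ e3 ?_ n
    rw [e2]
    exact Real.add_one_le_exp _
  have hfinal : ∑ z, ∑ z', ν z * ν z' * ∑ m, L z m * L z' m / P m ≤
      ∑ z, ∑ z', ν z * ν z' * Real.exp (n * ∑ y, D z y * D z' y / π y) := by
    refine Finset.sum_le_sum fun z _ => Finset.sum_le_sum fun z' _ => ?_
    by_cases hz : ν z = 0
    · simp [hz]
    by_cases hz' : ν z' = 0
    · simp [hz']
    exact mul_le_mul_of_nonneg_left (hcorr z z' hz hz') (mul_nonneg (hν z) (hν z'))
  linarith

end ChiSquare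

/-! ### Random rounding adapted to a channel -/

section Channel

variable {X Y : Type*} [Fintype X]

/-- The image of the signed measure with weights `q` under the channel with transition
probabilities `W`. -/
def pushChannel (W : X → Y → ℝ) (q : X → ℝ) (y : Y) : ℝ := ∑ x, q x * W x y

/-- The total weight `∑ x, W x y` with which a channel sends the message `y`. -/
def channelWeight (W : X → Y → ℝ) (y : Y) : ℝ := ∑ x, W x y

theorem channelWeight_nonneg {W : X → Y → ℝ} (hW : ∀ x y, 0 ≤ W x y) (y : Y) :
    0 ≤ channelWeight W y :=
  Finset.sum_nonneg fun x _ => hW x y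

theorem le_channelWeight {W : X → Y → ℝ} (hW : ∀ x y, 0 ≤ W x y) (x : X) (y : Y) :
    W x y ≤ channelWeight W y :=
  Finset.single_le_sum (f := fun x => W x y) (fun x _ => hW x y) (mem_univ x)

theorem eq_zero_of_channelWeight_eq_zero {W : X → Y → ℝ} (hW : ∀ x y, 0 ≤ W x y) {y : Y}
    (hy : channelWeight W y = 0) (x : X) : W x y = 0 :=
  le_antisymm (hy ▸ le_channelWeight hW x y) (hW x y)

theorem pushChannel_eq_zero {W : X → Y → ℝ} (hW : ∀ x y, 0 ≤ W x y) {y : Y}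
    (hy : channelWeight W y = 0) (q : X → ℝ) : pushChannel W q y = 0 :=
  Finset.sum_eq_zero fun x _ => by rw [eq_zero_of_channelWeight_eq_zero hW hy x, mul_zero]

theorem pushChannel_sub_const (W : X → Y → ℝ) (q : X → ℝ) (c : ℝ) (y : Y) :
    pushChannel W (fun x => q x - c) y = pushChannel W q y - c * channelWeight W y := by
  simp [pushChannel, channelWeight, sub_mul, Finset.sum_sub_distrib, Finset.mul_sum]

theorem pushChannel_const_mul (W : X → Y → ℝ) (q : X → ℝ) (c : ℝ) (y : Y) :
    pushChannel W (fun x => c * q x) y = c * pushChannel W q y := by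
  simp [pushChannel, Finset.mul_sum, mul_assoc]

variable [Fintype Y]

theorem sum_pushChannel {W : X → Y → ℝ} (hW1 : ∀ x, ∑ y, W x y = 1) (q : X → ℝ) :
    ∑ y, pushChannel W q y = ∑ x, q x := by
  unfold pushChannel
  rw [Finset.sum_comm]
  simp [← Finset.mul_sum, hW1]

/-- Constants are orthogonal to signed measures of total mass zero for the form
`(q, r) ↦ ∑ y, (W q) y * (W r) y / s y`, with `s = channelWeight W`. -/
theorem sum_pushChannel_mul_sub_const {W : X → Y → ℝ} (hW : ∀ x y, 0 ≤ W x y)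
    (hW1 : ∀ x, ∑ y, W x y = 1) {q : X → ℝ} (hq : ∑ x, q x = 0) (r : X → ℝ) (c : ℝ) :
    ∑ y, pushChannel W q y * pushChannel W (fun x => r x - c) y / channelWeight W y =
      ∑ y, pushChannel W q y * pushChannel W r y / channelWeight W y := by
  have h : ∀ y, pushChannel W q y * pushChannel W (fun x => r x - c) y / channelWeight W y =
      pushChannel W q y * pushChannel W r y / channelWeight W y - c * pushChannel W q y := by
    intro y
    by_cases hy : channelWeight W y = 0
    · simp [pushChannel_eq_zero hW hy]
    · rw [pushChannel_sub_const]
      field_simp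
  simp only [h, Finset.sum_sub_distrib, ← Finset.mul_sum, sum_pushChannel hW1, hq, mul_zero,
    sub_zero]

/-- Centering a signed measure decreases the form `q ↦ ∑ y, (W q) y ^ 2 / s y`. -/
theorem sum_pushChannel_centered_sq_le {W : X → Y → ℝ} (hW : ∀ x y, 0 ≤ W x y)
    (hW1 : ∀ x, ∑ y, W x y = 1) {q : X → ℝ} (r : X → ℝ) (c : ℝ) (hqr : ∀ x, q x = r x - c)
    (hq : ∑ x, q x = 0) :
    ∑ y, pushChannel W q y ^ 2 / channelWeight W y ≤
      ∑ y, pushChannel W r y ^ 2 / channelWeight W y := by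
  have h1 := sum_pushChannel_mul_sub_const hW hW1 hq q (-c)
  have hr : (fun x => q x - -c) = r := by
    ext x
    rw [hqr]
    ring
  rw [hr] at h1
  have h2 : ∀ y, pushChannel W r y ^ 2 / channelWeight W y =
      pushChannel W q y ^ 2 / channelWeight W y +
        (pushChannel W r y - pushChannel W q y) ^ 2 / channelWeight W y +
        2 * (pushChannel W q y * pushChannel W r y / channelWeight W y -
          pushChannel W q y * pushChannel W q y / channelWeight W y) := by
    intro y
    ring
  simp only [h2, Finset.sum_add_distrib, ← Finset.mul_sum, Finset.sum_sub_distrib, h1, sub_self,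
    mul_zero, add_zero]
  have : 0 ≤ ∑ y, (pushChannel W r y - pushChannel W q y) ^ 2 / channelWeight W y :=
    Finset.sum_nonneg fun y _ => div_nonneg (sq_nonneg _) (channelWeight_nonneg hW y)
  linarith

/-- Random rounding adapted to a channel `W`. The subgaussian rounding is applied to the vectors
`(e x, κ * W x · / √s) / √2`: the first block bounds the size of the perturbation itself, and the
second one makes the image of the perturbation under `W` small in all directions at once. -/
theorem exists_channel_rounding [DecidableEq X] {W : X → Y → ℝ} (hW : ∀ x y, 0 ≤ W x y)
    (A : Finset X) {κ : ℝ} (hκ : 0 < κ)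
    (hA : ∀ x ∈ A, κ ^ 2 * ∑ y, W x y ^ 2 / channelWeight W y ≤ 1) {ρ : ℝ} (hρ0 : 0 ≤ ρ)
    (hρ1 : ρ ≤ 1) :
    ∃ μ : FiniteLaw (X → ℝ),
      (∀ ω, (∀ x ∈ A, μ.val ω x = 0 ∨ μ.val ω x = 1) ∧ ∀ x ∉ A, μ.val ω x = ρ) ∧
      (∀ g : Y → ℝ, 2 / κ ^ 2 * ∑ y, g y ^ 2 ≤ 1 / 25 →
        (μ.expect fun s => Real.exp (∑ y, g y *
          (pushChannel W (fun x => s x - ρ) y / √(channelWeight W y)))) ≤ Real.exp (1 / 25)) ∧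
      (μ.expect fun s => (∑ x, (s x - ρ)) ^ 2) ≤ 6 * Fintype.card X ∧
      (μ.expect fun s => ∑ y, pushChannel W (fun x => s x - ρ) y ^ 2 / channelWeight W y) ≤
        6 * Fintype.card X / κ ^ 2 := by
  have h2 : (0 : ℝ) < √2 := by positivity
  have h22 : √2 ^ 2 = (2 : ℝ) := Real.sq_sqrt (by norm_num)
  let b : X → EuclideanSpace ℝ (X ⊕ Y) := fun x => WithLp.toLp 2
    (Sum.elim (Pi.single x (1 / √2)) fun y => κ / √2 * (W x y / √(channelWeight W y)))
  have hsqrt : ∀ y, √(channelWeight W y) ^ 2 = channelWeight W y :=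
    fun y => Real.sq_sqrt (channelWeight_nonneg hW y)
  have hb : ∀ x ∈ A, ‖b x‖ ≤ 1 := by
    intro x hx
    have e : ‖b x‖ ^ 2 = 1 / 2 + 1 / 2 * (κ ^ 2 * ∑ y, W x y ^ 2 / channelWeight W y) := by
      rw [EuclideanSpace.norm_sq_eq, Fintype.sum_sum_type]
      simp only [b, Sum.elim_inl, Sum.elim_inr, Real.norm_eq_abs, sq_abs, Finset.mul_sum]
      congr 1
      · rw [Finset.sum_eq_single x]
        · simp [h22]
        · intro x' _ hx'
          simp [hx']
        · simp
      · refine Finset.sum_congr rfl fun y _ => ?_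
        rw [mul_pow, div_pow, div_pow, h22, hsqrt]
        ring
    have := hA x hx
    have h3 : ‖b x‖ ^ 2 ≤ 1 := by linarith
    exact (sq_le_one_iff₀ (norm_nonneg _)).mp h3
  obtain ⟨μ, hμ, hμv⟩ := exists_subgaussian_rounding b A hb (fun _ => ρ) fun _ _ => ⟨hρ0, hρ1⟩
  have hcoordl : ∀ (s : X → ℝ) (x : X), (∑ x, (s x - ρ) • b x) (Sum.inl x) = (s x - ρ) / √2 := by
    intro s x
    simp only [b, WithLp.ofLp_sum, WithLp.ofLp_smul, Finset.sum_apply, Pi.smul_apply,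
      Sum.elim_inl, smul_eq_mul]
    rw [Finset.sum_eq_single x]
    · simp [div_eq_mul_inv]
    · intro x' _ hx'
      simp [Pi.single_eq_of_ne hx'.symm]
    · simp
  have hcoordr : ∀ (s : X → ℝ) (y : Y), (∑ x, (s x - ρ) • b x) (Sum.inr y) =
      κ / √2 * (pushChannel W (fun x => s x - ρ) y / √(channelWeight W y)) := by
    intro s y
    simp only [b, WithLp.ofLp_sum, WithLp.ofLp_smul, Finset.sum_apply, Pi.smul_apply,
      Sum.elim_inr, smul_eq_mul, pushChannel]
    rw [Finset.sum_div, Finset.mul_sum]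
    exact Finset.sum_congr rfl fun x _ => by ring
  refine ⟨μ, hμ, ?_, ?_, ?_⟩
  · intro g hg
    let v : EuclideanSpace ℝ (X ⊕ Y) := WithLp.toLp 2 (Sum.elim 0 fun y => √2 / κ * g y)
    have hv : ‖v‖ ^ 2 = 2 / κ ^ 2 * ∑ y, g y ^ 2 := by
      rw [EuclideanSpace.norm_sq_eq, Fintype.sum_sum_type]
      simp only [v, Sum.elim_inl, Sum.elim_inr, Real.norm_eq_abs, sq_abs, Finset.mul_sum]
      simp [mul_pow, div_pow]
    have hv5 : ‖v‖ ≤ 1 / 5 := by nlinarith [norm_nonneg v]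
    have h := hμv v hv5
    have hin : ∀ s : X → ℝ, inner ℝ (∑ x, (s x - ρ) • b x) v =
        ∑ y, g y * (pushChannel W (fun x => s x - ρ) y / √(channelWeight W y)) := by
      intro s
      rw [PiLp.inner_apply, Fintype.sum_sum_type]
      simp only [hcoordl, hcoordr]
      simp only [v, Sum.elim_inl, Sum.elim_inr, Pi.zero_apply, inner_zero_right,
        Finset.sum_const_zero, zero_add]
      refine Finset.sum_congr rfl fun y _ => ?_
      simp only [RCLike.inner_apply, conj_trivial]
      field_simp
    simp only [hin] at h
    exact h.trans (Real.exp_le_exp.mpr (hv ▸ hg))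
  · let v : EuclideanSpace ℝ (X ⊕ Y) := WithLp.toLp 2 (Sum.elim (fun _ => √2) 0)
    have hv : ‖v‖ ^ 2 = 2 * Fintype.card X := by
      rw [EuclideanSpace.norm_sq_eq, Fintype.sum_sum_type]
      simp [v, mul_comm]
    have h := μ.expect_inner_sq_le (fun s => ∑ x, (s x - ρ) • b x) hμv v
    have hin : ∀ s : X → ℝ, inner ℝ (∑ x, (s x - ρ) • b x) v = ∑ x, (s x - ρ) := by
      intro s
      rw [PiLp.inner_apply, Fintype.sum_sum_type]
      simp only [hcoordl, hcoordr]
      simp only [v, Sum.elim_inl, Sum.elim_inr, Pi.zero_apply, inner_zero_right,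
        Finset.sum_const_zero, add_zero]
      refine Finset.sum_congr rfl fun x _ => ?_
      simp only [RCLike.inner_apply, conj_trivial]
      field_simp
    simp only [hin, hv] at h
    linarith
  · have h := μ.expect_norm_sq_le b (fun s x => s x - ρ) hμv
    rw [le_div_iff₀ (by positivity)]
    have : (μ.expect fun s => κ ^ 2 / 2 *
        ∑ y, pushChannel W (fun x => s x - ρ) y ^ 2 / channelWeight W y) ≤
        μ.expect fun s => ‖∑ x, (s x - ρ) • b x‖ ^ 2 := by
      refine μ.expect_mono fun ω => ?_
      rw [EuclideanSpace.norm_sq_eq, Fintype.sum_sum_type]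
      simp only [hcoordl, hcoordr, Real.norm_eq_abs, sq_abs, Finset.mul_sum]
      have h0 : 0 ≤ ∑ x, ((μ.val ω x - ρ) / √2) ^ 2 := Finset.sum_nonneg fun x _ => sq_nonneg _
      refine le_trans (le_of_eq ?_) (le_add_of_nonneg_left h0)
      refine Finset.sum_congr rfl fun y _ => ?_
      rw [mul_pow, div_pow, div_pow, h22, hsqrt]
    rw [FiniteLaw.expect_const_mul] at this
    linarith

end Channel

/-! ### Testing uniformity through a channel -/

section Core

variable {k n : ℕ} {Y : Type*} [Fintype Y]

/-- The acceptance probability `f` of a test, as a function of `n` messages, makes the test an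
`α`-uniformity tester over `Fin k` when every user sends one message through the channel `W`. -/
structure IsChannelTester (W : Fin k → Y → ℝ) (f : (Fin n → Y) → ℝ) (α : ℝ) : Prop where
  channel_nonneg : ∀ x y, 0 ≤ W x y
  channel_sum : ∀ x, ∑ y, W x y = 1
  accept_nonneg : ∀ m, 0 ≤ f m
  accept_le_one : ∀ m, f m ≤ 1
  uniform : 2 / 3 ≤ ∑ m : Fin n → Y, (∏ i, pushChannel W (fun _ => 1 / (k : ℝ)) (m i)) * f m
  far : ∀ p : Fin k → ℝ, (∀ x, 0 ≤ p x) → ∑ x, p x = 1 →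
    α < 1 / 2 * ∑ x, |p x - 1 / (k : ℝ)| →
    ∑ m : Fin n → Y, (∏ i, pushChannel W p (m i)) * f m ≤ 1 / 3

/-- The second-moment method for perturbations `d z` of the uniform distribution, in terms of the
bilinear form of the channel. -/
theorem IsChannelTester.le_sum_exp {W : Fin k → Y → ℝ} {f : (Fin n → Y) → ℝ} {α : ℝ}
    (h : IsChannelTester W f α) (hk : 0 < k) {Z : Type*} [Fintype Z] (ν : Z → ℝ)
    (hν : ∀ z, 0 ≤ ν z) (hν1 : ∑ z, ν z = 1) (d : Z → Fin k → ℝ) (hd : ∀ z, ∑ x, d z x = 0)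
    (hpos : ∀ z, ν z ≠ 0 → ∀ x, 0 ≤ 1 / (k : ℝ) + d z x)
    (hfar : ∀ z, ν z ≠ 0 → α < 1 / 2 * ∑ x, |d z x|) :
    10 / 9 ≤ ∑ z, ∑ z', ν z * ν z' * Real.exp (n * (k * ∑ y,
      pushChannel W (d z) y * pushChannel W (d z') y / channelWeight W y)) := by
  have hk' : (0 : ℝ) < k := by exact_mod_cast hk
  have hπ : ∀ y, pushChannel W (fun _ => 1 / (k : ℝ)) y = 1 / k * channelWeight W y := by
    intro y
    simp [pushChannel, channelWeight, Finset.mul_sum]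
  have hadd : ∀ z y, pushChannel W (fun _ => 1 / (k : ℝ)) y + pushChannel W (d z) y =
      pushChannel W (fun x => 1 / (k : ℝ) + d z x) y := by
    intro z y
    simp [pushChannel, add_mul, Finset.sum_add_distrib]
  have key := le_sum_exp_correlation n (pushChannel W fun _ => 1 / (k : ℝ))
    (fun y => Finset.sum_nonneg fun x _ => mul_nonneg (by positivity) (h.channel_nonneg x y))
    (by rw [sum_pushChannel h.channel_sum]; simp [hk'.ne']) ν hν hν1
    (fun z => pushChannel W (d z)) (fun z => by rw [sum_pushChannel h.channel_sum, hd])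
    (fun z y hy => by
      rw [hπ] at hy
      refine pushChannel_eq_zero h.channel_nonneg ?_ _
      simpa [hk'.ne'] using hy)
    (fun z hz y => by
      rw [hadd]
      exact Finset.sum_nonneg fun x _ => mul_nonneg (hpos z hz x) (h.channel_nonneg x y))
    f h.accept_nonneg h.accept_le_one h.uniform
    (fun z hz => by
      simp only [hadd]
      refine h.far _ (hpos z hz) ?_ ?_
      · rw [Finset.sum_add_distrib, hd]
        simp [hk'.ne']
      · simpa using hfar z hz)
  refine key.trans (le_of_eq ?_)
  refine Finset.sum_congr rfl fun z _ => Finset.sum_congr rfl fun z' _ => ?_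
  have e : ∀ y, pushChannel W (d z) y * pushChannel W (d z') y /
      pushChannel W (fun _ => 1 / (k : ℝ)) y =
      k * (pushChannel W (d z) y * pushChannel W (d z') y / channelWeight W y) := by
    intro y
    rw [hπ]
    field_simp
  simp only [e, Finset.mul_sum]

/-- Over a small domain, a single distribution far from uniform gives the lower bound. -/
theorem IsChannelTester.small_domain {W : Fin k → Y → ℝ} {f : (Fin n → Y) → ℝ} {α : ℝ}
    (h : IsChannelTester W f α) (hk : 0 < k) (hα0 : 0 < α) (hα : α < 1 - 1 / (k : ℝ)) :
    1 / 160 ≤ n * α ^ 2 * k ^ 3 := by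
  classical
  have hk' : (0 : ℝ) < k := by exact_mod_cast hk
  have hk2 : (2 : ℝ) ≤ k := by
    have : 2 ≤ k := by
      by_contra hlt
      have : k = 1 := by omega
      subst this
      norm_num at hα
      linarith
    exact_mod_cast this
  have hk1 : 1 / (k : ℝ) ≤ 1 / 2 := one_div_le_one_div_of_le (by norm_num) hk2
  have hkpos : 0 < 1 / (k : ℝ) := by positivity
  have hmul : (k : ℝ) * (1 / k) = 1 := by field_simp
  set r : ℝ := 1 / k with hr
  -- the mixture `(1 - t) U + t δ₀` is far from uniform, and `t` is proportional to `α`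
  obtain ⟨t, ht0, ht1, ht, ht4⟩ : ∃ t : ℝ, 0 < t ∧ t ≤ 1 ∧ α < t * (1 - r) ∧ t ≤ 4 * α := by
    by_cases h2 : 4 * α ≤ 1
    · exact ⟨4 * α, by linarith, h2, by nlinarith, le_rfl⟩
    · exact ⟨1, one_pos, le_rfl, by linarith, by linarith⟩
  let x₀ : Fin k := ⟨0, hk⟩
  let d : Fin k → ℝ := fun x => t * ((if x = x₀ then 1 else 0) - r)
  have hd : ∑ x, d x = 0 := by
    simp only [d]
    rw [← Finset.mul_sum, Finset.sum_sub_distrib]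
    simp [hmul]
  have hd' : ∀ x, -(t * r) ≤ d x := by
    intro x
    simp only [d]
    split_ifs <;> nlinarith
  have key := h.le_sum_exp hk (Z := Unit) (fun _ => 1) (fun _ => zero_le_one) (by simp)
    (fun _ => d) (fun _ => hd) (fun _ _ x => by have := hd' x; nlinarith)
    (fun _ _ => by
      have e : ∀ x, t * (if x = x₀ then 2 * (1 - r) else 0) - d x ≤ |d x| := by
        intro x
        simp only [d]
        split_ifs
        · refine le_trans (le_of_eq ?_) (le_abs_self _)
          ring
        · refine le_trans (le_of_eq ?_) (neg_le_abs _)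
          ring
      have e2 := Finset.sum_le_sum fun x (_ : x ∈ univ) => e x
      rw [Finset.sum_sub_distrib, hd, ← Finset.mul_sum] at e2
      simp only [Finset.sum_ite_eq', mem_univ, if_true, sub_zero] at e2
      linarith)
  simp only [Finset.univ_unique, Finset.sum_const, Finset.card_singleton, one_smul, mul_one,
    one_mul] at key
  have hbound : ∑ y, pushChannel W d y * pushChannel W d y / channelWeight W y ≤
      t ^ 2 * k := by
    have e : ∀ y, pushChannel W d y * pushChannel W d y / channelWeight W y ≤
        t ^ 2 * channelWeight W y := by
      intro y
      have hs := channelWeight_nonneg h.channel_nonneg y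
      rcases hs.eq_or_lt with hs | hs
      · simp [← hs]
      rw [div_le_iff₀ hs]
      have hab : |pushChannel W d y| ≤ t * channelWeight W y := by
        unfold pushChannel channelWeight
        rw [Finset.mul_sum]
        refine (Finset.abs_sum_le_sum_abs _ _).trans (Finset.sum_le_sum fun x _ => ?_)
        rw [abs_mul, abs_of_nonneg (h.channel_nonneg x y)]
        refine mul_le_mul_of_nonneg_right ?_ (h.channel_nonneg x y)
        rw [abs_le]
        simp only [d]
        constructor <;> split_ifs <;> nlinarith
      have := pow_le_pow_left₀ (abs_nonneg _) hab 2
      rw [sq_abs] at this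
      nlinarith
    refine (Finset.sum_le_sum fun y _ => e y).trans (le_of_eq ?_)
    rw [← Finset.mul_sum]
    congr 1
    unfold channelWeight
    rw [Finset.sum_comm]
    simp [h.channel_sum]
  have hn : (0 : ℝ) ≤ n := Nat.cast_nonneg n
  have hle : (n : ℝ) * (k * ∑ y, pushChannel W d y * pushChannel W d y / channelWeight W y) ≤
      8 * (n * α ^ 2 * k ^ 3) := by
    have ht2 : t ^ 2 ≤ 16 * α ^ 2 := by nlinarith
    calc _ ≤ (n : ℝ) * (k * (16 * α ^ 2 * k)) := by
          gcongr
          exact hbound.trans (by gcongr)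
      _ = n * α ^ 2 * k ^ 2 * 16 := by ring
      _ ≤ n * α ^ 2 * k ^ 2 * (8 * k) := by gcongr; linarith
      _ = _ := by ring
  by_contra hlt
  push Not at hlt
  have hx : Real.exp (1 / 20) < 10 / 9 := by
    have := Real.exp_bound_div_one_sub_of_interval (x := (1 / 20 : ℝ)) (by norm_num) (by norm_num)
    refine this.trans_lt ?_
    norm_num
  have := key.trans (Real.exp_le_exp.mpr (hle.trans (by linarith : _ ≤ (1 / 20 : ℝ))))
  linarith

/-- The perturbations of the uniform distribution `U` used over large domains have the form
`U + (a / k) (s - sbar)`, where `s` takes the values zero and one on `A`, and is constant elsewhere.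
With `s` sparse, they may have total variation distance close to one from `U`. -/
theorem sum_abs_sub_mean_ge {X : Type*} [Fintype X] [DecidableEq X] (A : Finset X) (s : X → ℝ)
    (ρ sbar : ℝ) (h1 : ∀ x ∈ A, s x = 0 ∨ s x = 1) (h2 : ∀ x ∉ A, s x = ρ)
    (hbar : ∑ x, s x = Fintype.card X * sbar) :
    2 * (1 - sbar) * (Fintype.card X * sbar - ρ * (Aᶜ.card : ℝ)) ≤ ∑ x, |s x - sbar| := by
  have e : ∀ x, 2 * (1 - sbar) * (s x - if x ∈ Aᶜ then ρ else 0) - (s x - sbar) ≤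
      |s x - sbar| := by
    intro x
    by_cases hx : x ∈ A
    · simp only [mem_compl, hx, not_true_eq_false, if_false, sub_zero]
      rcases h1 x hx with h | h <;> rw [h]
      · refine le_trans (le_of_eq ?_) (neg_le_abs _)
        ring
      · refine le_trans (le_of_eq ?_) (le_abs_self _)
        ring
    · simp only [mem_compl, hx, not_false_eq_true, if_true, h2 x hx, sub_self, mul_zero]
      refine le_trans (le_of_eq ?_) (neg_le_abs _)
      ring
  have e2 := Finset.sum_le_sum fun x (_ : x ∈ univ) => e x
  rw [Finset.sum_sub_distrib, ← Finset.mul_sum, Finset.sum_sub_distrib, Finset.sum_sub_distrib,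
    hbar, Finset.sum_ite_mem] at e2
  simp only [univ_inter, Finset.sum_const, nsmul_eq_mul, Finset.card_univ] at e2
  linarith

end Core

/-! ### The channel lower bound over large domains -/

section LargeDomain

/-- Markov's inequality for a finite law. -/
theorem FiniteLaw.sum_filter_lt_le {S : Type*} (μ : FiniteLaw S) (f : S → ℝ)
    (hf : ∀ ω, 0 ≤ f (μ.val ω)) {t : ℝ} (ht : 0 < t) :
    ∑ ω with t < f (μ.val ω), μ.w ω ≤ μ.expect f / t := by
  rw [le_div_iff₀ ht, Finset.sum_mul]
  calc _ ≤ ∑ ω with t < f (μ.val ω), μ.w ω * f (μ.val ω) :=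
        Finset.sum_le_sum fun ω hω =>
          mul_le_mul_of_nonneg_left (mem_filter.mp hω).2.le (μ.w_nonneg ω)
    _ ≤ _ := Finset.sum_le_sum_of_subset_of_nonneg (filter_subset _ _)
        fun ω _ _ => mul_nonneg (μ.w_nonneg ω) (hf ω)

variable {k n : ℕ} {Y : Type*} [Fintype Y]

/-- A random point `s` of the cube, with coordinates zero and one except on a small part of the domain
on which the channel is too informative, such that with probability at least `19 / 20` the sum of the
coordinates is close to `θ * k` and the image of `s - θ` under the channel is small. -/
theorem exists_sparse_rounding {W : Fin k → Y → ℝ} (hW : ∀ x y, 0 ≤ W x y) {θ : ℝ}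
    (hθ0 : 0 < θ) (hθ1 : θ ≤ 1) (hk : 240 / θ ^ 4 ≤ k) {T : ℝ} (hT : 0 < T)
    (htr : ∑ x, ∑ y, W x y ^ 2 / channelWeight W y ≤ T) :
    ∃ (μ : FiniteLaw (Fin k → ℝ)) (A : Finset (Fin k)) (G : Finset μ.Ω),
      (Aᶜ.card : ℝ) ≤ θ * k ∧
      (∀ ω, (∀ x ∈ A, μ.val ω x = 0 ∨ μ.val ω x = 1) ∧ ∀ x ∉ A, μ.val ω x = θ) ∧
      (∀ g : Y → ℝ, 2 * T / (θ * k) * ∑ y, g y ^ 2 ≤ 1 / 25 →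
        (μ.expect fun s => Real.exp (∑ y, g y *
          (pushChannel W (fun x => s x - θ) y / √(channelWeight W y)))) ≤ Real.exp (1 / 25)) ∧
      19 / 20 ≤ ∑ ω ∈ G, μ.w ω ∧
      (∀ ω ∈ G, |∑ x, (μ.val ω x - θ)| ≤ θ ^ 2 * k) ∧
      ∀ ω ∈ G, ∑ y, pushChannel W (fun x => μ.val ω x - θ) y ^ 2 / channelWeight W y ≤
        240 * T / θ := by
  classical
  have hk' : (0 : ℝ) < k := lt_of_lt_of_le (by positivity) hk
  set κ : ℝ := √(θ * k / T) with hκ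
  have hκ2 : κ ^ 2 = θ * k / T := Real.sq_sqrt (by positivity)
  have hκ0 : 0 < κ := Real.sqrt_pos.mpr (by positivity)
  -- the points on which the channel is not too informative
  set A : Finset (Fin k) :=
    univ.filter fun x => κ ^ 2 * ∑ y, W x y ^ 2 / channelWeight W y ≤ 1 with hAdef
  have hAc : (Aᶜ.card : ℝ) ≤ θ * k := by
    have h1 : ∑ x ∈ Aᶜ, (1 : ℝ) ≤ ∑ x, κ ^ 2 * ∑ y, W x y ^ 2 / channelWeight W y := by
      refine (Finset.sum_le_sum fun x hx => ?_).trans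
        (Finset.sum_le_sum_of_subset_of_nonneg (subset_univ _) fun x _ _ => ?_)
      · simp only [hAdef, mem_compl, mem_filter, mem_univ, true_and, not_le] at hx
        exact hx.le
      · exact mul_nonneg (sq_nonneg _) (Finset.sum_nonneg fun y _ =>
          div_nonneg (sq_nonneg _) (channelWeight_nonneg hW y))
    rw [← Finset.mul_sum, hκ2] at h1
    simp only [Finset.sum_const, nsmul_eq_mul, mul_one] at h1
    refine h1.trans ?_
    calc _ ≤ θ * k / T * T := by gcongr
      _ = θ * k := by field_simp
  obtain ⟨μ, hμ, hexp, hvar, hnorm⟩ := exists_channel_rounding hW A hκ0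
    (fun x hx => (mem_filter.mp hx).2) hθ0.le hθ1
  rw [Fintype.card_fin] at hvar hnorm
  let form : (Fin k → ℝ) → ℝ := fun s =>
    ∑ y, pushChannel W (fun x => s x - θ) y ^ 2 / channelWeight W y
  have hform0 : ∀ s, 0 ≤ form s := fun s =>
    Finset.sum_nonneg fun y _ => div_nonneg (sq_nonneg _) (channelWeight_nonneg hW y)
  let G : Finset μ.Ω := univ.filter fun ω =>
    (∑ x, (μ.val ω x - θ)) ^ 2 ≤ (θ ^ 2 * k) ^ 2 ∧ form (μ.val ω) ≤ 240 * k / κ ^ 2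
  have hG : 19 / 20 ≤ ∑ ω ∈ G, μ.w ω := by
    have m1 := μ.sum_filter_lt_le (fun s => (∑ x, (s x - θ)) ^ 2) (fun _ => sq_nonneg _)
      (t := (θ ^ 2 * k) ^ 2) (by positivity)
    have m2 := μ.sum_filter_lt_le form (fun _ => hform0 _) (t := 240 * k / κ ^ 2) (by positivity)
    have b1 : (μ.expect fun s => (∑ x, (s x - θ)) ^ 2) / (θ ^ 2 * k) ^ 2 ≤ 1 / 40 := by
      rw [div_le_iff₀ (by positivity)]
      rw [div_le_iff₀ (by positivity)] at hk
      nlinarith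
    have b2 : μ.expect form / (240 * k / κ ^ 2) ≤ 1 / 40 := by
      rw [div_le_iff₀ (by positivity)]
      refine hnorm.trans (le_of_eq ?_)
      ring
    have hcov : ∑ ω, μ.w ω ≤ ∑ ω ∈ G, μ.w ω +
        (∑ ω with (θ ^ 2 * k) ^ 2 < (∑ x, (μ.val ω x - θ)) ^ 2, μ.w ω +
          ∑ ω with 240 * k / κ ^ 2 < form (μ.val ω), μ.w ω) := by
      simp only [G, Finset.sum_filter]
      rw [← Finset.sum_add_distrib, ← Finset.sum_add_distrib]
      refine Finset.sum_le_sum fun ω _ => ?_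
      have := μ.w_nonneg ω
      by_cases h2 : (θ ^ 2 * k) ^ 2 < (∑ x, (μ.val ω x - θ)) ^ 2
      · rw [if_pos h2]
        split_ifs <;> linarith
      · by_cases h3 : 240 * k / κ ^ 2 < form (μ.val ω)
        · rw [if_pos h3]
          split_ifs <;> linarith
        · rw [if_pos ⟨not_lt.mp h2, not_lt.mp h3⟩, if_neg h2, if_neg h3]
          linarith
    rw [μ.w_sum] at hcov
    linarith
  refine ⟨μ, A, G, hAc, hμ, fun g hg => hexp g ?_, hG,
    fun ω hω => abs_le_of_sq_le_sq (mem_filter.mp hω).2.1 (by positivity),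
    fun ω hω => (mem_filter.mp hω).2.2.trans (le_of_eq ?_)⟩
  · refine le_trans (le_of_eq ?_) hg
    rw [hκ2]
    field_simp
  · rw [hκ2]
    field_simp

/-- The correlation of two scaled perturbations, as a linear form in the second one. -/
theorem correlation_eq_linear_form {W : Fin k → Y → ℝ} (hW : ∀ x y, 0 ≤ W x y)
    (hW1 : ∀ x, ∑ y, W x y = 1) (hk : 0 < k) (a : ℝ) {q : Fin k → ℝ} (hq : ∑ x, q x = 0)
    (r : Fin k → ℝ) (c : ℝ) :
    n * (k * ∑ y, pushChannel W (fun x => a / k * q x) y *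
        pushChannel W (fun x => a / k * (r x - c)) y / channelWeight W y) =
      ∑ y, n * a ^ 2 / k * (pushChannel W q y / √(channelWeight W y)) *
        (pushChannel W r y / √(channelWeight W y)) := by
  have hk' : (0 : ℝ) < k := by exact_mod_cast hk
  have e2 : ∑ y, pushChannel W (fun x => a / k * q x) y *
      pushChannel W (fun x => a / k * (r x - c)) y / channelWeight W y =
      (a / k) ^ 2 * ∑ y, pushChannel W q y * pushChannel W r y / channelWeight W y := by
    rw [← sum_pushChannel_mul_sub_const hW hW1 hq r c, Finset.mul_sum]
    refine Finset.sum_congr rfl fun y _ => ?_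
    rw [pushChannel_const_mul, pushChannel_const_mul]
    ring
  rw [e2, Finset.mul_sum, Finset.mul_sum, Finset.mul_sum]
  refine Finset.sum_congr rfl fun y _ => ?_
  rw [mul_assoc, div_mul_div_comm, Real.mul_self_sqrt (channelWeight_nonneg hW y)]
  field_simp

/-- The channel lower bound over large domains. The parameter `θ` is the density of the support of
the perturbed distributions, the proportion of the domain that is left out because the channel
reveals too much on it, and the relative accuracy to which the density is controlled. -/
theorem IsChannelTester.large_domain {W : Fin k → Y → ℝ} {f : (Fin n → Y) → ℝ} {α : ℝ}
    (h : IsChannelTester W f α) {θ : ℝ} (hθ0 : 0 < θ) (hθ1 : θ < 1 / 10)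
    (hk : 240 / θ ^ 4 ≤ k) (hα0 : 0 < α) (hα : α ≤ 1 - 10 * θ) {T : ℝ} (hT : 0 < T)
    (htr : ∑ x, ∑ y, W x y ^ 2 / channelWeight W y ≤ T) :
    θ ^ 2 * ((1 - 10 * θ) * (1 + θ) * θ) ^ 4 / 12000 * k ^ 3 ≤ (n * α ^ 2 * T) ^ 2 := by
  classical
  have hk' : (0 : ℝ) < k := lt_of_lt_of_le (by positivity) hk
  have hk0 : 0 < k := by exact_mod_cast hk'
  have hW := h.channel_nonneg
  have hW1 := h.channel_sum
  obtain ⟨μ, A, G, hAc, hμ, hexp, hG, hGbar, hGform⟩ :=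
    exists_sparse_rounding hW hθ0 (by linarith) hk hT htr
  set M := ∑ ω ∈ G, μ.w ω with hM
  have hM0 : 0 < M := by linarith
  let ν : μ.Ω → ℝ := fun ω => if ω ∈ G then μ.w ω / M else 0
  have hν0 : ∀ ω, 0 ≤ ν ω := fun ω => by
    simp only [ν]
    split_ifs
    · exact div_nonneg (μ.w_nonneg ω) hM0.le
    · exact le_rfl
  have hνsum : ∑ ω, ν ω = 1 := by
    simp only [ν]
    rw [Finset.sum_ite_mem, univ_inter, ← Finset.sum_div, ← hM, div_self hM0.ne']
  have hνG : ∀ ω, ν ω ≠ 0 → ω ∈ G := fun ω hω => by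
    by_contra hc
    exact hω (if_neg hc)
  set c₀ : ℝ := (1 - 10 * θ) * (1 + θ) * θ with hc₀
  have hθ10 : 0 < 1 - 10 * θ := by linarith
  have hc₀pos : 0 < c₀ := by positivity
  -- the size of the perturbation
  set a : ℝ := α / c₀ with ha
  have ha0 : 0 < a := by positivity
  let sbar : μ.Ω → ℝ := fun ω => (∑ x, μ.val ω x) / k
  let q : μ.Ω → Fin k → ℝ := fun ω x => μ.val ω x - sbar ω
  have hq : ∀ ω, ∑ x, q ω x = 0 := by
    intro ω
    simp only [q, sbar, Finset.sum_sub_distrib, Finset.sum_const, card_univ, Fintype.card_fin,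
      nsmul_eq_mul]
    field_simp
    ring
  have hbar : ∀ ω ∈ G, θ - θ ^ 2 ≤ sbar ω ∧ sbar ω ≤ θ + θ ^ 2 := by
    intro ω hω
    have h2 := hGbar ω hω
    have e : ∑ x, (μ.val ω x - θ) = k * (sbar ω - θ) := by
      simp only [sbar, Finset.sum_sub_distrib, Finset.sum_const, card_univ, Fintype.card_fin,
        nsmul_eq_mul]
      field_simp
    rw [e, abs_le] at h2
    constructor
    · nlinarith [h2.1]
    · nlinarith [h2.2]
  have hs0 : ∀ ω x, 0 ≤ μ.val ω x := by
    intro ω x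
    by_cases hx : x ∈ A
    · rcases (hμ ω).1 x hx with h | h <;> rw [h]
      exact zero_le_one
    · rw [(hμ ω).2 x hx]
      exact hθ0.le
  have hac : a * c₀ = α := div_mul_cancel₀ _ hc₀pos.ne'
  have key := h.le_sum_exp hk0 ν hν0 hνsum (fun ω x => a / k * q ω x)
    (fun ω => by rw [← Finset.mul_sum, hq, mul_zero])
    (fun ω hω x => by
      have hb := hbar ω (hνG ω hω)
      have hs := hs0 ω x
      have h1 : a * sbar ω ≤ 1 := by
        have h2 : a * (1 - 10 * θ) * (θ * (1 + θ)) ≤ (1 - 10 * θ) := by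
          calc _ = α := by rw [← hac, hc₀]; ring
            _ ≤ _ := hα
        have h3 : a * (θ * (1 + θ)) ≤ 1 := by
          refine le_of_mul_le_mul_left ?_ hθ10
          linarith
        calc a * sbar ω ≤ a * (θ * (1 + θ)) := by
              refine mul_le_mul_of_nonneg_left ?_ ha0.le
              linarith [hb.2]
          _ ≤ 1 := h3
      have h4 : 0 ≤ 1 + a * q ω x := by
        simp only [q]
        nlinarith [mul_nonneg ha0.le hs]
      calc (0 : ℝ) ≤ (1 + a * q ω x) / k := by positivity
        _ = _ := by ring)
    (fun ω hω => by
      have hb := hbar ω (hνG ω hω)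
      have h1 := sum_abs_sub_mean_ge A (μ.val ω) θ (sbar ω) (hμ ω).1 (hμ ω).2
        (by simp only [sbar, Fintype.card_fin]; field_simp)
      rw [Fintype.card_fin] at h1
      have h2 : 2 * ((1 - θ - θ ^ 2) * (k * (θ - 2 * θ ^ 2))) ≤ ∑ x, |μ.val ω x - sbar ω| := by
        refine le_trans ?_ h1
        have h3 : k * (θ - 2 * θ ^ 2) ≤ k * sbar ω - θ * (Aᶜ.card : ℝ) := by nlinarith [hb.1]
        have h4 : 0 ≤ k * (θ - 2 * θ ^ 2) := mul_nonneg hk'.le (by nlinarith)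
        have h5 : 1 - θ - θ ^ 2 ≤ 1 - sbar ω := by linarith [hb.2]
        have h6 : 0 ≤ 1 - sbar ω := by nlinarith [hb.2]
        have := mul_le_mul h5 h3 h4 h6
        linarith
      have e : ∑ x, |a / k * q ω x| = a / k * ∑ x, |μ.val ω x - sbar ω| := by
        rw [Finset.mul_sum]
        refine Finset.sum_congr rfl fun x _ => ?_
        rw [abs_mul, abs_of_nonneg (by positivity : 0 ≤ a / k)]
      rw [e]
      have h7 : c₀ < (1 - θ - θ ^ 2) * (θ - 2 * θ ^ 2) := by
        have : (1 - 10 * θ) * (1 + θ) < (1 - θ - θ ^ 2) * (1 - 2 * θ) := by nlinarith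
        calc c₀ < (1 - θ - θ ^ 2) * (1 - 2 * θ) * θ := by
              rw [hc₀]
              exact mul_lt_mul_of_pos_right this hθ0
          _ = _ := by ring
      calc α = a * c₀ := hac.symm
        _ < a * ((1 - θ - θ ^ 2) * (θ - 2 * θ ^ 2)) := mul_lt_mul_of_pos_left h7 ha0
        _ = 1 / 2 * (a / k * (2 * ((1 - θ - θ ^ 2) * (k * (θ - 2 * θ ^ 2))))) := by
          field_simp
        _ ≤ _ := by gcongr)
  by_contra hlt
  push Not at hlt
  -- if `n` is too small, the correlation is subgaussian with a tiny variance proxy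
  have hinner : ∀ ω ∈ G, ∑ ω', ν ω' * Real.exp (n * (k * ∑ y,
      pushChannel W (fun x => a / k * q ω x) y * pushChannel W (fun x => a / k * q ω' x) y /
        channelWeight W y)) ≤ Real.exp (1 / 25) / M := by
    intro ω hω
    let g : Y → ℝ := fun y => n * a ^ 2 / k * (pushChannel W (q ω) y / √(channelWeight W y))
    have hg : 2 * T / (θ * k) * ∑ y, g y ^ 2 ≤ 1 / 25 := by
      have e1 : ∑ y, g y ^ 2 =
          (n * a ^ 2 / k) ^ 2 * ∑ y, pushChannel W (q ω) y ^ 2 / channelWeight W y := by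
        rw [Finset.mul_sum]
        refine Finset.sum_congr rfl fun y _ => ?_
        simp only [g]
        rw [mul_pow, div_pow (pushChannel W (q ω) y), Real.sq_sqrt (channelWeight_nonneg hW y)]
      have e2 : ∑ y, pushChannel W (q ω) y ^ 2 / channelWeight W y ≤ 240 * T / θ :=
        (sum_pushChannel_centered_sq_le hW hW1 (fun x => μ.val ω x - θ) (sbar ω - θ)
          (fun x => by simp only [q]; ring) (hq ω)).trans (hGform ω hω)
      rw [e1]
      have e3 : (n * a ^ 2 * T) ^ 2 ≤ θ ^ 2 / 12000 * k ^ 3 := by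
        have : (n * α ^ 2 * T) ^ 2 = (n * a ^ 2 * T) ^ 2 * c₀ ^ 4 := by rw [← hac]; ring
        rw [this] at hlt
        refine le_of_mul_le_mul_right (hlt.le.trans (le_of_eq ?_)) (pow_pos hc₀pos 4)
        ring
      calc _ ≤ 2 * T / (θ * k) * ((n * a ^ 2 / k) ^ 2 * (240 * T / θ)) := by gcongr
        _ = 480 / (θ ^ 2 * k ^ 3) * (n * a ^ 2 * T) ^ 2 := by
          field_simp
          ring
        _ ≤ 480 / (θ ^ 2 * k ^ 3) * (θ ^ 2 / 12000 * k ^ 3) := by gcongr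
        _ = 1 / 25 := by
          field_simp
          norm_num
    have hcorr : ∀ ω', n * (k * ∑ y, pushChannel W (fun x => a / k * q ω x) y *
        pushChannel W (fun x => a / k * q ω' x) y / channelWeight W y) =
        ∑ y, g y * (pushChannel W (fun x => μ.val ω' x - θ) y / √(channelWeight W y)) := by
      intro ω'
      rw [← correlation_eq_linear_form hW hW1 hk0 a (hq ω) (fun x => μ.val ω' x - θ)
        (sbar ω' - θ)]
      have : (fun x => a / k * (μ.val ω' x - θ - (sbar ω' - θ))) = fun x => a / k * q ω' x := by
        ext x
        simp only [q]
        ring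
      rw [this]
    simp only [hcorr]
    calc _ ≤ ∑ ω', μ.w ω' / M * Real.exp (∑ y, g y *
          (pushChannel W (fun x => μ.val ω' x - θ) y / √(channelWeight W y))) := by
          refine Finset.sum_le_sum fun ω' _ => mul_le_mul_of_nonneg_right ?_ (Real.exp_pos _).le
          simp only [ν]
          split_ifs
          · exact le_rfl
          · exact div_nonneg (μ.w_nonneg _) hM0.le
      _ = (μ.expect fun s => Real.exp (∑ y, g y *
          (pushChannel W (fun x => s x - θ) y / √(channelWeight W y)))) / M := by
          rw [FiniteLaw.expect, Finset.sum_div]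
          exact Finset.sum_congr rfl fun ω' _ => by ring
      _ ≤ _ := by
          gcongr
          exact hexp g hg
  have htotal : ∑ ω, ∑ ω', ν ω * ν ω' * Real.exp (n * (k * ∑ y,
      pushChannel W (fun x => a / k * q ω x) y * pushChannel W (fun x => a / k * q ω' x) y /
        channelWeight W y)) ≤ Real.exp (1 / 25) / M := by
    calc _ ≤ ∑ ω, ν ω * (Real.exp (1 / 25) / M) := by
          refine Finset.sum_le_sum fun ω _ => ?_
          simp only [mul_assoc]
          rw [← Finset.mul_sum]
          by_cases hω : ν ω = 0
          · simp [hω]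
          · exact mul_le_mul_of_nonneg_left (hinner ω (hνG ω hω)) (hν0 ω)
      _ = _ := by rw [← Finset.sum_mul, hνsum, one_mul]
  have hx : Real.exp (1 / 25) ≤ 25 / 24 := by
    have := Real.exp_bound_div_one_sub_of_interval (x := (1 / 25 : ℝ)) (by norm_num) (by norm_num)
    refine this.trans ?_
    norm_num
  have hlast : Real.exp (1 / 25) / M < 10 / 9 := by
    rw [div_lt_iff₀ hM0]
    linarith
  linarith

/-- The lower bound for testing uniformity through a channel, in terms of the trace of the matrix
`∑ y, W x y * W x' y / s y`. -/
theorem IsChannelTester.exists_const_le (α₀ : ℝ) (hα₀ : α₀ < 1) (hα₀pos : 0 < α₀) :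
    ∃ c : ℝ, 0 < c ∧ ∀ (k n : ℕ) (Y : Type) [Fintype Y] (W : Fin k → Y → ℝ)
      (f : (Fin n → Y) → ℝ) (α T : ℝ), IsChannelTester W f α → 0 < k → 0 < α → α ≤ α₀ →
      α < 1 - 1 / (k : ℝ) → 1 ≤ T → ∑ x, ∑ y, W x y ^ 2 / channelWeight W y ≤ T →
      c * k ^ 3 ≤ (n * α ^ 2 * T) ^ 2 := by
  set θ : ℝ := (1 - α₀) / 10 with hθ
  have hθ0 : 0 < θ := by rw [hθ]; linarith
  have hθα : 1 - 10 * θ = α₀ := by rw [hθ]; ring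
  set K : ℝ := 240 / θ ^ 4 with hK
  have hK0 : 0 < K := by positivity
  set c₁ : ℝ := θ ^ 2 * ((1 - 10 * θ) * (1 + θ) * θ) ^ 4 / 12000 with hc₁
  have hc₁0 : 0 < c₁ := by
    have : 0 < 1 - 10 * θ := by rw [hθα]; exact hα₀pos
    positivity
  refine ⟨min c₁ (1 / (160 ^ 2 * K ^ 9)), lt_min hc₁0 (by positivity), ?_⟩
  intro k n Y _ W f α T h hk hα0 hα hαk hT htr
  have hk' : (0 : ℝ) < k := by exact_mod_cast hk
  by_cases hkK : K ≤ k
  · refine le_trans ?_ (h.large_domain hθ0 (by rw [hθ]; linarith) hkK hα0 (by rwa [hθα])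
      (by linarith) htr)
    exact mul_le_mul_of_nonneg_right (min_le_left _ _) (by positivity)
  · have hs := h.small_domain hk hα0 hαk
    push Not at hkK
    have h1 : 1 / 160 / (k : ℝ) ^ 3 ≤ n * α ^ 2 * T := by
      rw [div_le_iff₀ (by positivity)]
      have : (0 : ℝ) ≤ n * α ^ 2 * k ^ 3 := by positivity
      nlinarith
    calc _ ≤ 1 / (160 ^ 2 * K ^ 9) * (k : ℝ) ^ 3 :=
          mul_le_mul_of_nonneg_right (min_le_right _ _) (by positivity)
      _ ≤ 1 / (160 ^ 2 * k ^ 9) * (k : ℝ) ^ 3 := by gcongr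
      _ = (1 / 160 / (k : ℝ) ^ 3) ^ 2 := by
        field_simp
      _ ≤ _ := pow_le_pow_left₀ (by positivity) h1 2

end LargeDomain

/-! ### From shuffle protocols to channels -/

section Protocol

theorem map_eval_indepLaw {A : Type} {n : ℕ} (q : Fin n → PMF A) (i : Fin n) :
    (indepLaw q).map (fun m => m i) = q i := by
  induction n with
  | zero => exact i.elim0
  | succ n ih =>
    rw [indepLaw, PMF.map_bind]
    simp only [PMF.map_comp]
    refine Fin.cases ?_ (fun j => ?_) i
    · have : ∀ a : A, ((fun m : Fin (n + 1) → A => m 0) ∘ fun v : Fin n → A => Fin.cons a v) =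
          Function.const _ a := by
        intro a
        ext v
        simp
      simp only [this, PMF.map_const, PMF.bind_pure]
    · have : ∀ a : A, ((fun m : Fin (n + 1) → A => m j.succ) ∘
          fun v : Fin n → A => (Fin.cons a v : Fin (n + 1) → A)) = fun v => v j := by
        intro a
        ext v
        simp
      simp only [this, ih, PMF.bind_const]

theorem indepLaw_bind {X A : Type} [Fintype X] {n : ℕ} (p : Fin n → PMF X) (R : X → PMF A) :
    ((indepLaw p).bind fun x => indepLaw fun i => R (x i)) = indepLaw fun i => (p i).bind R := by
  classical
  ext m
  simp only [PMF.bind_apply, indepLaw_apply, tsum_fintype]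
  rw [Finset.prod_univ_sum, Fintype.piFinset_univ]
  exact Finset.sum_congr rfl fun x _ => Finset.prod_mul_distrib.symm

theorem shuffler_toOuterMeasure_mem {Y : Type} [DecidableEq Y] (l : List Y) (w : Y) :
    (shuffler l).toOuterMeasure {l' | w ∈ l'} = if w ∈ l then 1 else 0 := by
  have hmem : ∀ σ : Equiv.Perm (Fin l.length),
      w ∈ (List.ofFn fun i => l.get (σ i)) ↔ w ∈ l := by
    intro σ
    rw [List.mem_ofFn, List.mem_iff_get]
    constructor
    · rintro ⟨i, hi⟩
      exact ⟨σ i, hi⟩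
    · rintro ⟨i, hi⟩
      exact ⟨σ.symm i, by simpa using hi⟩
  rw [shuffler, PMF.toOuterMeasure_map_apply]
  simp only [Set.preimage_ofPred_eq, hmem]
  split_ifs with h
  · rw [PMF.toOuterMeasure_apply_eq_one_iff]
    exact fun _ _ => h
  · simp [h]

theorem mem_support_of_mem_support_indepLaw {A : Type} {n : ℕ} {q : Fin n → PMF A}
    {m : Fin n → A} (hm : m ∈ (indepLaw q).support) (i : Fin n) : m i ∈ (q i).support := by
  rw [PMF.mem_support_iff, indepLaw_apply] at hm
  exact (PMF.mem_support_iff _ _).mpr (Finset.prod_ne_zero_iff.mp hm i (mem_univ i))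

theorem mem_flatten_ofFn {Y : Type} {n : ℕ} (m : Fin n → List Y) (w : Y) :
    w ∈ (List.ofFn m).flatten ↔ ∃ i, w ∈ m i := by
  simp only [List.mem_flatten, List.mem_ofFn]
  constructor
  · rintro ⟨l, ⟨i, rfl⟩, h⟩
    exact ⟨i, h⟩
  · rintro ⟨i, h⟩
    exact ⟨_, ⟨i, rfl⟩, h⟩

theorem indepLaw_toOuterMeasure_eval {A : Type} {n : ℕ} (q : Fin n → PMF A) (i : Fin n) (a : A) :
    (indepLaw q).toOuterMeasure {m | m i = a} = q i a := by
  rw [← PMF.toOuterMeasure_apply_singleton, ← map_eval_indepLaw q i,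
    PMF.toOuterMeasure_map_apply]
  rfl

namespace ShuffleProtocol

variable {X Z : Type} {Y : Type}

/-- The probability that the message `w` occurs in the output of the shuffler. -/
theorem shuffled_toOuterMeasure_mem (P : ShuffleProtocol X Y Z) {n : ℕ} (x : Fin n → X)
    (u : Fin P.r → Bool) (w : Y) :
    (P.shuffled x u).toOuterMeasure {l | w ∈ l} =
      (indepLaw fun i => P.randomiser (x i) u).toOuterMeasure {m | ∃ i, w ∈ m i} := by
  classical
  rw [shuffled, PMF.toOuterMeasure_bind_apply, PMF.toOuterMeasure_apply]
  refine tsum_congr fun m => ?_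
  rw [shuffler_toOuterMeasure_mem]
  by_cases h : ∃ i, w ∈ m i
  · rw [if_pos ((mem_flatten_ofFn m w).mpr h), mul_one, Set.indicator_of_mem (by exact h)]
  · rw [if_neg (mt (mem_flatten_ofFn m w).mp h), mul_zero, Set.indicator_of_notMem (by exact h)]

theorem randomiser_le_shuffled (P : ShuffleProtocol X Y Z) {n : ℕ} (x : Fin n → X)
    (u : Fin P.r → Bool) (w : Y) (i : Fin n) :
    P.randomiser (x i) u [w] ≤ (P.shuffled x u).toOuterMeasure {l | w ∈ l} := by
  rw [shuffled_toOuterMeasure_mem,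
    ← indepLaw_toOuterMeasure_eval (fun i => P.randomiser (x i) u) i [w]]
  refine MeasureTheory.measure_mono fun m hm => ⟨i, ?_⟩
  rw [show m i = [w] from hm]
  exact List.mem_singleton_self w

theorem shuffled_le_sum_randomiser (P : ShuffleProtocol X Y Z) (hP : P.IsSingleMessage) {n : ℕ}
    (x : Fin n → X) (u : Fin P.r → Bool) (w : Y) :
    (P.shuffled x u).toOuterMeasure {l | w ∈ l} ≤ ∑ i, P.randomiser (x i) u [w] := by
  rw [shuffled_toOuterMeasure_mem]
  simp only [← indepLaw_toOuterMeasure_eval (fun i => P.randomiser (x i) u)]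
  have h : (indepLaw fun i => P.randomiser (x i) u).toOuterMeasure {m | ∃ i, w ∈ m i} ≤
      (indepLaw fun i => P.randomiser (x i) u).toOuterMeasure (⋃ i, {m | m i = [w]}) := by
    refine PMF.toOuterMeasure_mono _ ?_
    rintro m ⟨⟨i, hi⟩, hm⟩
    refine Set.mem_iUnion.mpr ⟨i, ?_⟩
    obtain ⟨a, ha⟩ := List.length_eq_one_iff.mp
      (hP (x i) u (m i) (mem_support_of_mem_support_indepLaw hm i))
    rw [ha, List.mem_singleton] at hi
    change m i = [w]
    rw [ha, hi]
  exact h.trans (MeasureTheory.measure_iUnion_fintype_le _ _)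

/-- In a single-message shuffle private protocol, the randomiser is locally private, with a privacy
parameter that is larger by the logarithm of the number of users. Indeed, for one user with data `x`
and the others with data `x'`, the message `w` occurs with at least the probability that the first
user sends it; if all users have data `x'`, it occurs with at most `n` times the probability that one
of them sends it. -/
theorem randomiser_le_of_isShuffleDP [DecidableEq X] (P : ShuffleProtocol X Y Z)
    (hP : P.IsSingleMessage) {n : ℕ} (hn : 0 < n) {ε δ : ℝ} (h : P.IsShuffleDP n ε δ)
    (u : Fin P.r → Bool) (x x' : X) (w : Y) :
    P.randomiser x u [w] ≤
      ENNReal.ofReal (Real.exp ε) * (n * P.randomiser x' u [w]) + ENNReal.ofReal δ := by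
  let i : Fin n := ⟨0, hn⟩
  let v' : Fin n → X := fun _ => x'
  let v : Fin n → X := Function.update v' i x
  have hd : hammingDist v v' ≤ 1 := by
    rw [hammingDist, ← Finset.card_singleton i]
    refine Finset.card_le_card fun j hj => ?_
    rw [mem_filter] at hj
    rw [mem_singleton]
    by_contra hji
    exact hj.2 (Function.update_of_ne hji _ _)
  calc P.randomiser x u [w] = P.randomiser (v i) u [w] := by simp [v]
    _ ≤ (P.shuffled v u).toOuterMeasure {l | w ∈ l} := P.randomiser_le_shuffled v u w i
    _ ≤ ENNReal.ofReal (Real.exp ε) * (P.shuffled v' u).toOuterMeasure {l | w ∈ l} +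
        ENNReal.ofReal δ := h u v v' hd _
    _ ≤ _ := by
      gcongr
      refine (P.shuffled_le_sum_randomiser hP v' u w).trans (le_of_eq ?_)
      simp [v']

end ShuffleProtocol

/-- The bit strings of length at most `ℓ`. -/
def bitStrings (ℓ : ℕ) : Finset (List Bool) :=
  (Finset.range (ℓ + 1)).biUnion fun j => univ.image fun v : Fin j → Bool => List.ofFn v

theorem mem_bitStrings {ℓ : ℕ} {w : List Bool} (hw : w.length ≤ ℓ) : w ∈ bitStrings ℓ := by
  rw [bitStrings, mem_biUnion]
  exact ⟨w.length, by simpa [Nat.lt_succ_iff] using hw, by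
    rw [mem_image]
    exact ⟨w.get, mem_univ _, List.ofFn_get w⟩⟩

theorem card_bitStrings_le (ℓ : ℕ) : (bitStrings ℓ).card ≤ 2 ^ (ℓ + 1) := by
  calc (bitStrings ℓ).card ≤ ∑ j ∈ Finset.range (ℓ + 1), 2 ^ j := by
        refine Finset.card_biUnion_le.trans (Finset.sum_le_sum fun j _ => ?_)
        refine Finset.card_image_le.trans (le_of_eq ?_)
        simp
    _ ≤ 2 ^ (ℓ + 1) := (Nat.geomSum_lt le_rfl fun j hj => Finset.mem_range.mp hj).le

namespace ShuffleProtocol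

variable {k : ℕ} {n ℓ : ℕ}

/-- The transition probabilities of the randomiser of a single-message protocol with messages of at
most `ℓ` bits, with public random bits `u`. -/
noncomputable def channel {X Z : Type} (P : ShuffleProtocol X (List Bool) Z) (u : Fin P.r → Bool)
    (ℓ : ℕ) (x : X) (y : bitStrings ℓ) : ℝ :=
  (P.randomiser x u [(y : List Bool)]).toReal

theorem exists_of_mem_support_randomiser {X Z : Type} (P : ShuffleProtocol X (List Bool) Z)
    (hP : P.IsSingleMessage) (hℓ : P.SendsAtMost ℓ) (u : Fin P.r → Bool) (x : X)
    {m : List (List Bool)} (hm : m ∈ (P.randomiser x u).support) :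
    ∃ y : bitStrings ℓ, [(y : List Bool)] = m := by
  obtain ⟨a, rfl⟩ := List.length_eq_one_iff.mp (hP x u m hm)
  exact ⟨⟨a, mem_bitStrings (by simpa using hℓ x u _ hm)⟩, rfl⟩

theorem sum_channel {X Z : Type} (P : ShuffleProtocol X (List Bool) Z) (hP : P.IsSingleMessage)
    (hℓ : P.SendsAtMost ℓ) (u : Fin P.r → Bool) (x : X) : ∑ y, P.channel u ℓ x y = 1 := by
  have hinj : Function.Injective fun y : bitStrings ℓ => [(y : List Bool)] := by
    intro y y' h
    exact Subtype.ext (List.singleton_injective h)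
  have h := (P.randomiser x u).tsum_coe
  rw [← hinj.tsum_eq (by
    intro m hm
    exact P.exists_of_mem_support_randomiser hP hℓ u x hm), tsum_fintype] at h
  unfold channel
  rw [← ENNReal.toReal_sum fun y _ => PMF.apply_ne_top _ _, h, ENNReal.toReal_one]

/-- The probability that the analyser accepts the shuffled messages `m`. -/
noncomputable def acceptProb {X : Type} (P : ShuffleProtocol X (List Bool) Bool)
    (u : Fin P.r → Bool) (m : Fin n → bitStrings ℓ) : ℝ :=
  (((shuffler (List.ofFn fun i => [(m i : List Bool)]).flatten).bind fun y =>
    P.analyser y u) true).toReal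

theorem outputOn_eq_of_isPrivateCoin {X Y Z : Type} [Fintype X] (P : ShuffleProtocol X Y Z)
    (hr : P.IsPrivateCoin) (u : Fin P.r → Bool) (p : PMF X) :
    P.outputOn n p = (indepLaw fun _ : Fin n => p.bind fun x => P.randomiser x u).bind fun m =>
      (shuffler (List.ofFn m).flatten).bind fun y => P.analyser y u := by
  have hu : ∀ u', u' = u := by
    intro u'
    have : IsEmpty (Fin P.r) := ⟨fun i => Nat.not_lt_zero i.1 (i.2.trans_eq hr)⟩
    exact Subsingleton.elim _ _
  have hout : ∀ x : Fin n → X, P.output x = (P.shuffled x u).bind fun y => P.analyser y u := by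
    intro x
    rw [output]
    have : (fun u' => (P.shuffled x u').bind fun y => P.analyser y u') =
        fun _ => (P.shuffled x u).bind fun y => P.analyser y u := by
      funext u'
      rw [hu u']
    rw [this, PMF.bind_const]
  rw [outputOn, ← indepLaw_bind, PMF.bind_bind]
  simp only [hout, shuffled, PMF.bind_bind]

theorem outputOn_true_toReal {X : Type} [Fintype X] (P : ShuffleProtocol X (List Bool) Bool)
    (hr : P.IsPrivateCoin) (hP : P.IsSingleMessage) (hℓ : P.SendsAtMost ℓ) (u : Fin P.r → Bool)
    (p : PMF X) :
    (P.outputOn n p true).toReal = ∑ m : Fin n → bitStrings ℓ,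
      (∏ i, pushChannel (P.channel u ℓ) (fun x => (p x).toReal) (m i)) * P.acceptProb u m := by
  have hinj : Function.Injective
      fun (m : Fin n → bitStrings ℓ) (i : Fin n) => [(m i : List Bool)] := by
    intro m m' h
    funext i
    exact Subtype.ext (List.singleton_injective (congrFun h i))
  rw [P.outputOn_eq_of_isPrivateCoin hr u, PMF.bind_apply, ← hinj.tsum_eq, tsum_fintype,
    ENNReal.toReal_sum]
  · refine Finset.sum_congr rfl fun m _ => ?_
    rw [ENNReal.toReal_mul, indepLaw_apply, ENNReal.toReal_prod]
    congr 1
    refine Finset.prod_congr rfl fun i _ => ?_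
    rw [PMF.bind_apply, tsum_fintype, ENNReal.toReal_sum]
    · exact Finset.sum_congr rfl fun x _ => ENNReal.toReal_mul
    · exact fun x _ => ENNReal.mul_ne_top (PMF.apply_ne_top _ _) (PMF.apply_ne_top _ _)
  · exact fun m _ => ENNReal.mul_ne_top (PMF.apply_ne_top _ _) (PMF.apply_ne_top _ _)
  · intro m hm
    have hm' : m ∈ (indepLaw fun _ : Fin n => p.bind fun x => P.randomiser x u).support :=
      (PMF.mem_support_iff _ _).mpr (left_ne_zero_of_mul hm)
    have : ∀ i, ∃ y : bitStrings ℓ, [(y : List Bool)] = m i := by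
      intro i
      obtain ⟨x, -, hx⟩ := (PMF.mem_support_bind_iff _ _ _).mp
        (mem_support_of_mem_support_indepLaw hm' i)
      exact P.exists_of_mem_support_randomiser hP hℓ u x hx
    choose y hy using this
    exact ⟨y, funext hy⟩

theorem isChannelTester [NeZero k] (P : ShuffleProtocol (Fin k) (List Bool) Bool)
    (hr : P.IsPrivateCoin) (hP : P.IsSingleMessage) (hℓ : P.SendsAtMost ℓ) {α : ℝ}
    (h : P.IsUniformityTester n α) (u : Fin P.r → Bool) :
    IsChannelTester (n := n) (P.channel u ℓ) (P.acceptProb u) α where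
  channel_nonneg _ _ := ENNReal.toReal_nonneg
  channel_sum := P.sum_channel hP hℓ u
  accept_nonneg _ := ENNReal.toReal_nonneg
  accept_le_one m := by
    have := ENNReal.toReal_mono ENNReal.one_ne_top (PMF.coe_le_one
      ((shuffler (List.ofFn fun i => [(m i : List Bool)]).flatten).bind fun y =>
        P.analyser y u) true)
    simpa [acceptProb] using this
  uniform := by
    have h1 := ENNReal.toReal_mono (PMF.apply_ne_top _ _) h.1
    rw [P.outputOn_true_toReal hr hP hℓ u] at h1
    simpa using h1
  far p hp hp1 hα := by
    have hsum : ∑ x, ENNReal.ofReal (p x) = 1 := by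
      rw [← ENNReal.ofReal_sum_of_nonneg fun x _ => hp x, hp1, ENNReal.ofReal_one]
    let p' : PMF (Fin k) := PMF.ofFintype (fun x => ENNReal.ofReal (p x)) hsum
    have hp' : ∀ x, (p' x).toReal = p x := fun x => by
      simp [p', PMF.ofFintype_apply, ENNReal.toReal_ofReal (hp x)]
    have h1 := ENNReal.toReal_mono (PMF.apply_ne_top _ _) (h.2 p' (by simpa [tvDist, hp'] using hα))
    have h2 : (P.outputOn n p' true).toReal + (P.outputOn n p' false).toReal = 1 := by
      rw [← ENNReal.toReal_add (PMF.apply_ne_top _ _) (PMF.apply_ne_top _ _)]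
      have := (P.outputOn n p').tsum_coe
      rw [tsum_fintype, Fintype.sum_bool] at this
      rw [this, ENNReal.toReal_one]
    rw [P.outputOn_true_toReal hr hP hℓ u] at h2
    simp only [hp'] at h2
    rw [ENNReal.toReal_div, ENNReal.toReal_ofNat, ENNReal.toReal_ofNat] at h1
    linarith

theorem channel_le_of_isShuffleDP {X Z : Type} [DecidableEq X]
    (P : ShuffleProtocol X (List Bool) Z) (hP : P.IsSingleMessage) (hn : 0 < n) {ε δ : ℝ}
    (hδ : 0 ≤ δ) (h : P.IsShuffleDP n ε δ) (u : Fin P.r → Bool) (x x' : X) (y : bitStrings ℓ) :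
    P.channel u ℓ x y ≤ n * Real.exp ε * P.channel u ℓ x' y + δ := by
  have h1 := P.randomiser_le_of_isShuffleDP hP hn h u x x' (y : List Bool)
  have htop : ENNReal.ofReal (Real.exp ε) * (n * P.randomiser x' u [(y : List Bool)]) ≠ ⊤ :=
    ENNReal.mul_ne_top ENNReal.ofReal_ne_top
      (ENNReal.mul_ne_top (ENNReal.natCast_ne_top n) (PMF.apply_ne_top _ _))
  have h2 := ENNReal.toReal_mono (ENNReal.add_ne_top.mpr ⟨htop, ENNReal.ofReal_ne_top⟩) h1
  rw [ENNReal.toReal_add htop ENNReal.ofReal_ne_top, ENNReal.toReal_mul, ENNReal.toReal_mul,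
    ENNReal.toReal_ofReal (Real.exp_pos ε).le, ENNReal.toReal_ofReal hδ,
    ENNReal.toReal_natCast] at h2
  unfold channel
  linarith

end ShuffleProtocol

/-! ### The trace of a private channel -/

section Trace

variable {k : ℕ} {Y : Type*} [Fintype Y] {W : Fin k → Y → ℝ}

theorem trace_le_card (hW : ∀ x y, 0 ≤ W x y) (hW1 : ∀ x, ∑ y, W x y = 1) :
    ∑ x, ∑ y, W x y ^ 2 / channelWeight W y ≤ k := by
  calc _ ≤ ∑ x, ∑ y, W x y := by
        refine Finset.sum_le_sum fun x _ => Finset.sum_le_sum fun y _ => ?_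
        refine div_le_of_le_mul₀ (channelWeight_nonneg hW y) (hW x y) ?_
        rw [sq]
        exact mul_le_mul_of_nonneg_left (le_channelWeight hW x y) (hW x y)
    _ = k := by simp [hW1]

/-- A locally private channel sends each message with a probability that is bounded in terms of its
average over the data, so that it reveals little on the data. -/
theorem trace_le_of_private (hk : 0 < k) (hW : ∀ x y, 0 ≤ W x y) (hW1 : ∀ x, ∑ y, W x y = 1)
    {e δ : ℝ} (hδ : 0 ≤ δ) (h : ∀ x x' y, W x y ≤ e * W x' y + δ) :
    ∑ x, ∑ y, W x y ^ 2 / channelWeight W y ≤ e + δ * Fintype.card Y := by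
  have hk' : (0 : ℝ) < k := by exact_mod_cast hk
  have hmax : ∀ x y, W x y ≤ e * (channelWeight W y / k) + δ := by
    intro x y
    have h1 : ∑ _x' : Fin k, W x y ≤ ∑ x', (e * W x' y + δ) := Finset.sum_le_sum fun x' _ => h x x' y
    rw [Finset.sum_add_distrib, ← Finset.mul_sum] at h1
    simp only [Finset.sum_const, card_univ, Fintype.card_fin, nsmul_eq_mul] at h1
    have h2 : W x y ≤ (e * channelWeight W y + k * δ) / k := by
      rw [le_div_iff₀ hk']
      unfold channelWeight
      linarith
    refine h2.trans (le_of_eq ?_)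
    field_simp
  have hy : ∀ y, ∑ x, W x y ^ 2 / channelWeight W y ≤ e * (channelWeight W y / k) + δ := by
    intro y
    rcases (channelWeight_nonneg hW y).eq_or_lt with hs | hs
    · simpa [← hs] using hδ
    · rw [← Finset.sum_div, div_le_iff₀ hs]
      calc ∑ x, W x y ^ 2 ≤ ∑ x, (e * (channelWeight W y / k) + δ) * W x y := by
            refine Finset.sum_le_sum fun x _ => ?_
            rw [sq]
            exact mul_le_mul_of_nonneg_right (hmax x y) (hW x y)
        _ = _ := by rw [← Finset.mul_sum, channelWeight]
  rw [Finset.sum_comm]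
  refine (Finset.sum_le_sum fun y _ => hy y).trans (le_of_eq ?_)
  have hs : ∑ y, channelWeight W y = k := by
    unfold channelWeight
    rw [Finset.sum_comm]
    simp [hW1]
  rw [Finset.sum_add_distrib, ← Finset.mul_sum, ← Finset.sum_div, hs, div_self hk'.ne', mul_one]
  simp [mul_comm]

end Trace

end Protocol

end

/-! ### The lower bound on the number of users -/

section Bounds

/-- The bound `n * E ^ 2 + δ * (2 * L)` on the trace of the channel of a private protocol grows with
the number `n` of users. Depending on which summand dominates, solving for `n` gives one or the other
lower bound, with halved exponents in the first case. Here `E = e ^ (ε / 2)` and `L = 2 ^ ℓ`. -/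
theorem min_le_of_trace_bound {c n k α E δ L : ℝ} (hc : 0 < c) (hn : 0 ≤ n) (hk : 0 < k)
    (hα : 0 < α) (hE : 0 < E) (hδ : 0 < δ) (hL : 0 < L)
    (h : c * k ^ (3 / 2 : ℝ) ≤ n * α ^ 2 * (n * E ^ 2 + δ * (2 * L))) :
    min (√(c / 2)) (c / 4) * min (k ^ (3 / 4 : ℝ) / (α * E)) (k ^ (3 / 2 : ℝ) / (α ^ 2 * δ * L))
      ≤ n := by
  have hk32 : (k ^ (3 / 4 : ℝ)) ^ 2 = k ^ (3 / 2 : ℝ) := by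
    rw [← Real.rpow_natCast, ← Real.rpow_mul hk.le]
    norm_num
  have h34 : 0 < k ^ (3 / 4 : ℝ) := Real.rpow_pos_of_pos hk _
  have h32 : 0 < k ^ (3 / 2 : ℝ) := Real.rpow_pos_of_pos hk _
  by_cases hcase : c / 2 * k ^ (3 / 2 : ℝ) ≤ (n * α * E) ^ 2
  · have h1 : √(c / 2) * k ^ (3 / 4 : ℝ) ≤ n * α * E := by
      refine (sq_le_sq₀ (by positivity) (by positivity)).mp ?_
      rwa [mul_pow, Real.sq_sqrt (by positivity), hk32]
    calc _ ≤ √(c / 2) * (k ^ (3 / 4 : ℝ) / (α * E)) := by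
          gcongr
          · exact min_le_left _ _
          · exact min_le_left _ _
      _ ≤ n := by
          rw [← mul_div_assoc, div_le_iff₀ (by positivity)]
          linarith
  · have h1 : c / 4 * k ^ (3 / 2 : ℝ) ≤ n * (α ^ 2 * δ * L) := by
      push Not at hcase
      nlinarith
    calc _ ≤ c / 4 * (k ^ (3 / 2 : ℝ) / (α ^ 2 * δ * L)) := by
          gcongr
          · exact min_le_right _ _
          · exact min_le_right _ _
      _ ≤ n := by
          rw [← mul_div_assoc, div_le_iff₀ (by positivity)]
          exact h1

theorem sqrt_mul_rpow_le {c k x : ℝ} (hc : 0 ≤ c) (hk : 0 ≤ k) (hx : 0 ≤ x)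
    (h : c * k ^ 3 ≤ x ^ 2) : √c * k ^ (3 / 2 : ℝ) ≤ x := by
  have hk32 : (k ^ (3 / 2 : ℝ)) ^ 2 = k ^ 3 := by
    rw [← Real.rpow_natCast, ← Real.rpow_mul hk, ← Real.rpow_natCast]
    norm_num
  refine (sq_le_sq₀ (by positivity) hx).mp ?_
  rwa [mul_pow, Real.sq_sqrt hc, hk32]

end Bounds

theorem mainTheorem4 (α₀ : ℝ) (hα₀ : α₀ < 1) :
    ∃ c : ℝ, 0 < c ∧
      ∀ (k : ℕ) [NeZero k] (n ℓ : ℕ) (ε δ α : ℝ),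
        0 < ε → 0 < δ → δ ≤ 1 → 0 < α → α ≤ α₀ → α < 1 - 1 / (k : ℝ) →
        ∀ P : ShuffleProtocol (Fin k) (List Bool) Bool,
          P.IsPrivateCoin → P.IsSingleMessage → P.SendsAtMost ℓ →
          P.IsShuffleDP n ε δ → P.IsUniformityTester n α →
          c * (min ((k : ℝ) ^ (3 / 4 : ℝ) / (α * Real.exp (ε / 2)))
                  ((k : ℝ) ^ (3 / 2 : ℝ) / (α ^ 2 * δ * 2 ^ ℓ))
                + (k : ℝ) ^ (1 / 2 : ℝ) / α ^ 2) ≤ (n : ℝ) ∧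
          (δ ≤ (k : ℝ) ^ (3 / 4 : ℝ) / 2 ^ ℓ →
            c * ((k : ℝ) ^ (3 / 4 : ℝ) / (α * Real.exp (ε / 2))
                + (k : ℝ) ^ (1 / 2 : ℝ) / α ^ 2) ≤ (n : ℝ)) := by
  rcases le_or_gt α₀ 0 with hneg | hα₀pos
  · -- there is no admissible `α`
    exact ⟨1, one_pos, fun k _ n ℓ ε δ α _ _ _ hα hα' => absurd (hα.trans_le hα') hneg.not_gt⟩
  obtain ⟨c, hc, hmain⟩ := IsChannelTester.exists_const_le α₀ hα₀ hα₀pos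
  set r : ℝ := √c with hr
  have hr0 : 0 < r := Real.sqrt_pos.mpr hc
  set b : ℝ := min (√(r / 2)) (r / 4) with hb
  have hb0 : 0 < b := lt_min (Real.sqrt_pos.mpr (by positivity)) (by positivity)
  refine ⟨b / 2, by positivity, ?_⟩
  intro k _ n ℓ ε δ α hε hδ _ hα hα' hαk P hcoin hsingle hbits hDP htest
  have hk : 0 < k := Nat.pos_of_ne_zero (NeZero.ne k)
  have hk' : (0 : ℝ) < k := by exact_mod_cast hk
  have hk1 : (1 : ℝ) ≤ k := by exact_mod_cast hk
  have hT := P.isChannelTester hcoin hsingle hbits htest fun _ => false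
  -- the trace is at most `k` without any privacy
  have hsamples : r * (k : ℝ) ^ (1 / 2 : ℝ) ≤ n * α ^ 2 := by
    have h1 := sqrt_mul_rpow_le hc.le hk'.le (by positivity)
      (hmain k n _ _ _ α k hT hk hα hα' hαk hk1 (trace_le_card hT.channel_nonneg hT.channel_sum))
    have h2 : (k : ℝ) ^ (3 / 2 : ℝ) = (k : ℝ) ^ (1 / 2 : ℝ) * k := by
      rw [← Real.rpow_add_one hk'.ne']
      norm_num
    rw [h2, ← mul_assoc] at h1
    exact le_of_mul_le_mul_right h1 hk'
  have hk12 : 0 < (k : ℝ) ^ (1 / 2 : ℝ) := Real.rpow_pos_of_pos hk' _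
  have hn : 0 < n := by
    rcases Nat.eq_zero_or_pos n with h0 | h0
    · rw [h0, Nat.cast_zero, zero_mul] at hsamples
      exact absurd (mul_pos hr0 hk12) hsamples.not_gt
    · exact h0
  have hn1 : (1 : ℝ) ≤ n := by exact_mod_cast hn
  have htrace : ∑ x, ∑ y, P.channel (fun _ => false) ℓ x y ^ 2 /
      channelWeight (P.channel (fun _ => false) ℓ) y ≤
      n * Real.exp (ε / 2) ^ 2 + δ * (2 * 2 ^ ℓ) := by
    refine (trace_le_of_private hk hT.channel_nonneg hT.channel_sum hδ.le
      (P.channel_le_of_isShuffleDP hsingle hn hδ.le hDP fun _ => false)).trans ?_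
    have h1 : Real.exp ε = Real.exp (ε / 2) ^ 2 := by
      rw [← Real.exp_nat_mul]
      congr 1
      push_cast
      ring
    have h2 : (Fintype.card (bitStrings ℓ) : ℝ) ≤ 2 * 2 ^ ℓ := by
      rw [Fintype.card_coe, ← pow_succ']
      exact_mod_cast card_bitStrings_le ℓ
    rw [h1]
    gcongr
  have hexp : 1 ≤ Real.exp (ε / 2) := Real.one_le_exp (by positivity)
  have hT1 : 1 ≤ n * Real.exp (ε / 2) ^ 2 + δ * (2 * 2 ^ ℓ) := by
    have h1 : 1 ≤ n * Real.exp (ε / 2) ^ 2 := one_le_mul_of_one_le_of_one_le hn1 (one_le_pow₀ hexp)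
    have h2 : 0 ≤ δ * (2 * 2 ^ ℓ) := by positivity
    linarith
  have hpriv := min_le_of_trace_bound hr0 (Nat.cast_nonneg n) hk' hα (Real.exp_pos (ε / 2)) hδ
    (by positivity : (0 : ℝ) < 2 ^ ℓ) (sqrt_mul_rpow_le hc.le hk'.le (by positivity)
      (hmain k n _ _ _ α _ hT hk hα hα' hαk hT1 htrace))
  rw [← hb] at hpriv
  have hfirst : b / 2 * (min ((k : ℝ) ^ (3 / 4 : ℝ) / (α * Real.exp (ε / 2)))
      ((k : ℝ) ^ (3 / 2 : ℝ) / (α ^ 2 * δ * 2 ^ ℓ)) + (k : ℝ) ^ (1 / 2 : ℝ) / α ^ 2) ≤ n := by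
    have h1 : b * ((k : ℝ) ^ (1 / 2 : ℝ) / α ^ 2) ≤ n := by
      have hbr : b ≤ r := (min_le_right _ _).trans (by linarith)
      rw [← mul_div_assoc, div_le_iff₀ (by positivity)]
      exact (mul_le_mul_of_nonneg_right hbr hk12.le).trans hsamples
    linarith
  refine ⟨hfirst, fun hδk => ?_⟩
  -- for such `δ`, the first term attains the minimum
  have hmin : (k : ℝ) ^ (3 / 4 : ℝ) / (α * Real.exp (ε / 2)) ≤
      (k : ℝ) ^ (3 / 2 : ℝ) / (α ^ 2 * δ * 2 ^ ℓ) := by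
    have h34 : 0 < (k : ℝ) ^ (3 / 4 : ℝ) := Real.rpow_pos_of_pos hk' _
    have h32 : (k : ℝ) ^ (3 / 2 : ℝ) = (k : ℝ) ^ (3 / 4 : ℝ) * (k : ℝ) ^ (3 / 4 : ℝ) := by
      rw [← Real.rpow_add hk']
      norm_num
    rw [le_div_iff₀ (by positivity)] at hδk
    rw [div_le_div_iff₀ (by positivity) (by positivity), h32, mul_assoc (_ ^ _) (_ ^ _) (α * _)]
    refine mul_le_mul_of_nonneg_left ?_ h34.le
    calc α ^ 2 * δ * 2 ^ ℓ = α * (α * (δ * 2 ^ ℓ)) := by ring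
      _ ≤ α * (Real.exp (ε / 2) * (k : ℝ) ^ (3 / 4 : ℝ)) := by
          gcongr
          linarith
      _ = _ := by ring
  rwa [min_eq_left hmin] at hfirst
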